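/- Let $0<r<1$, $\alpha>0$, $\beta\in\mathbb{R}$. Let $C$ be the space of continuous real $2\pi$-periodic functions with $\|\varphi\|_C=\max_t|\varphi(t)|$, and let $L_\infty$ be the space of measurable essentially bounded real $2\pi$-periodic functions with $\|\varphi\|_\infty=\operatorname{ess\,sup}_t|\varphi(t)|$. For $\mathfrak N\in\{C,L_\infty\}$ let $C^{\alpha,r}_\beta\mathfrak N$ be the set of functions $f$ which for all $x\in\mathbb{R}$ have the form $$f(x)=\frac{a_0}{2}+\frac1\pi\int_{-\pi}^{\pi}P_{\alpha,r,\beta}(x-t)\varphi(t)\,dt,\qquad a_0\in\mathbb{R},\ \varphi\in\mathfrak N,\ \int_{-\pi}^{\pi}\varphi(t)\,dt=0,$$ where $P_{\alpha,r,\beta}(t)=\sum_{k=1}^\infty e^{-\alpha k^r}\cos\left(kt-\frac{\beta\pi}{2}\right)$; then $\varphi$ is called the generalized derivative of $f$ and is denoted by $f^{\alpha,r}_\beta$. Let $E_n(\varphi)_{L_\infty}$ and $E_n(\varphi)_C$ be the best approximations of $\varphi$ in $L_\infty$ and in $C$, respectively, by real trigonometric polynomials of order at most $n-1$. Let $\tilde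 S_{n-1}(f;\cdot)$ be the trigonometric polynomial of order at most $n-1$ which interpolates $f$ at the nodes $\frac{2k\pi}{2n-1}$, $k=0,1,\dots,2n-2$, i.e. $\tilde S_{n-1}(f;x)=\frac{2}{2n-1}\sum_{k=0}^{2n-2}f\left(\frac{2k\pi}{2n-1}\right)D_{n-1}\left(x-\frac{2k\pi}{2n-1}\right)$ with $D_{n-1}(t)=\frac12+\sum_{k=1}^{n-1}\cos kt$. Let $n\in\mathbb{N}$, $n\ge 1$, be any number such that $$\frac{\ln(\pi n)}{\alpha r n^r}+\frac{\alpha r}{n^{1-r}}\le\frac{1}{(3\pi)^3}$$ (all sufficiently large $n$ have this property), and let $x\in\mathbb{R}$. Then: 1. There is a number $\gamma^*=\gamma^*_{n,\infty}(\alpha,r,\beta,x)$ with $|\gamma^*|<20\pi^4$ such that for every $f\in C^{\alpha,r}_\beta L_\infty$ $$|f(x)-\tilde S_{n-1}(f;x)|\le 2e^{-\alpha n^r}\left|\sin\frac{(2n-1)x}{2}\right|\left(\frac{4}{\pi^2}\ln\frac{n^{1-r}}{\alpha r}+\gamma^*\right)E_n(f^{\alpha,r}_\beta)_{L_\infty}.$$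 2. For every $f\in C^{\alpha,r}_\beta C$ there is a function $\mathcal F=\mathcal F(f;n;x;\cdot)\in C^{\alpha,r}_\beta C$ with $E_n(\mathcal F^{\alpha,r}_\beta)_C=E_n(f^{\alpha,r}_\beta)_C$ and a number $\gamma^{**}=\gamma^{**}_{n,\infty}(\alpha,r,\beta,f,x)$ with $|\gamma^{**}|<1951$ such that $$|\mathcal F(x)-\tilde S_{n-1}(\mathcal F;x)|=2e^{-\alpha n^r}\left|\sin\frac{(2n-1)x}{2}\right|\left(\frac{4}{\pi^2}\ln\frac{n^{1-r}}{\alpha r}+\gamma^{**}\right)E_n(f^{\alpha,r}_\beta)_C.$$ -/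

import Mathlib

open Real MeasureTheory

noncomputable section

namespace GenPoisson

/-- The generalized Poisson kernel
`P_{α,r,β}(t) = ∑_{k ≥ 1} e^{-α k^r} cos (k t - β π / 2)`. -/
def kernel (α r β t : ℝ) : ℝ :=
  ∑' k : ℕ, Real.exp (-α * ((k : ℝ) + 1) ^ r) * Real.cos (((k : ℝ) + 1) * t - β * π / 2)

/-- `f = a₀/2 + (1/π) ∫_{-π}^{π} P_{α,r,β}(· - t) φ(t) dt` for some real `a₀`, with `φ ⊥ 1`:
`f` is a generalized Poisson integral of `φ`, and `φ` is a generalized derivative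
`f^{α,r}_β` of `f`. -/
def IsGenDeriv (α r β : ℝ) (f φ : ℝ → ℝ) : Prop :=
  (∫ t in (-π)..π, φ t) = 0 ∧
    ∃ a₀ : ℝ, ∀ x : ℝ, f x = a₀ / 2 + 1 / π * ∫ t in (-π)..π, kernel α r β (x - t) * φ t

/-- The space `L_∞` of measurable essentially bounded `2π`-periodic functions. -/
def SpaceLInfty : Set (ℝ → ℝ) :=
  {φ | Function.Periodic φ (2 * π) ∧ MemLp φ ⊤ volume}

/-- The space `C` of continuous `2π`-periodic functions. -/
def SpaceC : Set (ℝ → ℝ) :=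
  {φ | Function.Periodic φ (2 * π) ∧ Continuous φ}

/-- The norm of `L_∞`: the essential supremum of `|φ|`. -/
def normLInfty (φ : ℝ → ℝ) : ℝ := (eLpNorm φ ⊤ volume).toReal

/-- The norm of `C`: the maximum of `|φ|`. -/
def normC (φ : ℝ → ℝ) : ℝ := ⨆ t : ℝ, |φ t|

/-- Real trigonometric polynomials of order at most `n - 1` (for `n ≥ 1`). -/
def TrigPoly (n : ℕ) : Set (ℝ → ℝ) :=
  {T | ∃ a b : ℕ → ℝ, ∀ x : ℝ,
    T x = ∑ k ∈ Finset.range n, (a k * Real.cos (k * x) + b k * Real.sin (k * x))}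

/-- Best approximation `E_n(φ)_{L_∞}` by trigonometric polynomials of order `n - 1`. -/
def bestLInfty (n : ℕ) (φ : ℝ → ℝ) : ℝ :=
  sInf ((fun T : ℝ → ℝ => normLInfty (φ - T)) '' TrigPoly n)

/-- Best uniform approximation `E_n(φ)_C` by trigonometric polynomials of order `n - 1`. -/
def bestC (n : ℕ) (φ : ℝ → ℝ) : ℝ :=
  sInf ((fun T : ℝ → ℝ => normC (φ - T)) '' TrigPoly n)

/-- The Dirichlet kernel `D_{n-1}(t) = 1/2 + ∑_{k=1}^{n-1} cos (k t)`. -/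
def dirichlet (n : ℕ) (t : ℝ) : ℝ := 1 / 2 + ∑ k ∈ Finset.Ico 1 n, Real.cos (k * t)

/-- The nodes `2 k π / (2 n - 1)`. -/
def node (n k : ℕ) : ℝ := 2 * k * π / (2 * n - 1)

/-- The Lagrange interpolation trigonometric polynomial `S̃_{n-1}(f; ·)` of order `n - 1` at the
nodes `2 k π / (2 n - 1)`, `k = 0, …, 2 n - 2`. -/
def interp (n : ℕ) (f : ℝ → ℝ) (x : ℝ) : ℝ :=
  2 / (2 * n - 1) * ∑ k ∈ Finset.range (2 * n - 1), f (node n k) * dirichlet n (x - node n k)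

theorem trigPoly_add {n : ℕ} {S T : ℝ → ℝ} (hS : S ∈ TrigPoly n) (hT : T ∈ TrigPoly n) :
    (fun x => S x + T x) ∈ TrigPoly n := by
  obtain ⟨a, b, h⟩ := hS
  obtain ⟨c, d, g⟩ := hT
  refine ⟨fun k => a k + c k, fun k => b k + d k, fun x => ?_⟩
  simp only [h, g, ← Finset.sum_add_distrib]
  exact Finset.sum_congr rfl fun k _ => by ring

theorem trigPoly_smul {n : ℕ} {S : ℝ → ℝ} (c : ℝ) (hS : S ∈ TrigPoly n) :
    (fun x => c * S x) ∈ TrigPoly n := by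
  obtain ⟨a, b, h⟩ := hS
  refine ⟨fun k => c * a k, fun k => c * b k, fun x => ?_⟩
  simp only [h, Finset.mul_sum]
  exact Finset.sum_congr rfl fun k _ => by ring

theorem trigPoly_sum {n : ℕ} {ι : Type*} (s : Finset ι) (S : ι → ℝ → ℝ)
    (hS : ∀ i, S i ∈ TrigPoly n) : (fun x => ∑ i ∈ s, S i x) ∈ TrigPoly n := by
  classical
  induction s using Finset.induction_on with
  | empty => exact ⟨0, 0, fun x => by simp⟩
  | insert i s hi ih =>
    simp only [Finset.sum_insert hi]
    exact trigPoly_add (hS i) ih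

theorem dirichlet_mem {n : ℕ} (hn : 1 ≤ n) (y : ℝ) :
    (fun x => dirichlet n (x - y)) ∈ TrigPoly n := by
  refine ⟨fun k => if k = 0 then 1 / 2 else Real.cos (k * y), fun k => Real.sin (k * y),
    fun x => ?_⟩
  rw [Finset.range_eq_Ico, Finset.sum_eq_sum_Ico_succ_bot (by omega)]
  simp only [dirichlet]
  congr 1
  · simp
  · refine Finset.sum_congr rfl fun k hk => ?_
    have : k ≠ 0 := by have := (Finset.mem_Ico.1 hk).1; omega
    simp only [this, if_false, mul_sub, Real.cos_sub]
    ring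

/-- `S̃_{n-1}(f; ·)` is a trigonometric polynomial of order `n - 1`. -/
theorem interp_mem {n : ℕ} (hn : 1 ≤ n) (f : ℝ → ℝ) : interp n f ∈ TrigPoly n :=
  trigPoly_smul _ (trigPoly_sum _ _ fun _ => trigPoly_smul _ (dirichlet_mem hn _))

theorem sin_mul_dirichlet {n : ℕ} (hn : 1 ≤ n) (t : ℝ) :
    2 * Real.sin (t / 2) * dirichlet n t = Real.sin ((2 * n - 1) * t / 2) := by
  induction n, hn using Nat.le_induction with
  | base => simp [dirichlet]; ring_nf
  | succ n hn ih =>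
    have h : dirichlet (n + 1) t = dirichlet n t + Real.cos (n * t) := by
      unfold dirichlet
      rw [Finset.sum_Ico_succ_top hn, add_assoc]
    rw [h, mul_add, ih]
    have e1 : (2 * (n : ℝ) - 1) * t / 2 = n * t - t / 2 := by ring
    have e2 : (2 * ((n + 1 : ℕ) : ℝ) - 1) * t / 2 = n * t + t / 2 := by push_cast; ring
    rw [e1, e2, Real.sin_sub, Real.sin_add]
    ring

/-- `S̃_{n-1}(f; ·)` coincides with `f` at the nodes. -/
theorem interp_node {n : ℕ} (hn : 1 ≤ n) (f : ℝ → ℝ) {j : ℕ} (hj : j < 2 * n - 1) :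
    interp n f (node n j) = f (node n j) := by
  have hN : (0 : ℝ) < 2 * n - 1 := by
    have : (1 : ℝ) ≤ n := by exact_mod_cast hn
    linarith
  rw [interp, Finset.sum_eq_single j]
  · have : dirichlet n 0 = (2 * n - 1) / 2 := by
      simp [dirichlet, Nat.cast_sub hn]; ring
    rw [sub_self, this]
    field_simp
  · intro k hk0 hkj
    have hk := Finset.mem_range.1 hk0
    have h := sin_mul_dirichlet hn (node n j - node n k)
    have e : (2 * (n : ℝ) - 1) * (node n j - node n k) / 2 = ((j - k : ℤ) : ℝ) * π := by
      unfold node; push_cast; field_simp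
    rw [e, Real.sin_int_mul_pi] at h
    have hs : Real.sin ((node n j - node n k) / 2) ≠ 0 := by
      intro h0
      obtain ⟨m, hm⟩ := Real.sin_eq_zero_iff.1 h0
      have hm' : ((m * (2 * n - 1) : ℤ) : ℝ) = ((j - k : ℤ) : ℝ) := by
        have hp := Real.pi_pos.ne'
        unfold node at hm
        push_cast
        field_simp at hm
        linarith
      have hm2 : m * (2 * n - 1) = (j : ℤ) - k := by exact_mod_cast hm'
      have hm0 : m ≠ 0 := by rintro rfl; apply hkj; omega
      have h1 : |m * (2 * (n : ℤ) - 1)| < 2 * n - 1 := by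
        rw [hm2, abs_lt]; omega
      rw [abs_mul, abs_of_pos (by omega : (0 : ℤ) < 2 * n - 1)] at h1
      have := Int.one_le_abs hm0
      nlinarith
    have : dirichlet n (node n j - node n k) = 0 := by
      rcases mul_eq_zero.1 h with h | h
      · exact absurd (by linarith) hs
      · exact h
    rw [this, mul_zero]
  · intro h
    exact absurd (Finset.mem_range.2 hj) h

end GenPoisson

end

noncomputable section

namespace GenPoisson

/-! The interpolation error at `x` is `1/π ∫ K φ` with `K = errKernel n α r β x`. Everything rests
on computing the `L¹` norm of `K` up to a relative error O(1) and on the orthogonality of `K` to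
`TrigPoly n`.

Put y = (2n-1)x/2. By aliasing, the harmonic of frequency k = m(2n-1)+j with |j| < n is interpolated
by the one of frequency j, with error -2 sin(my) times a sine of frequency k in t. It vanishes for k
< n; for n ≤ k ≤ 3n-2 the factor is exactly -2 sin y; always it is at most 2k|sin y|, and the
weights beyond 3n-2 are negligible. So `K` is -2 sin y times a pure sine series, up to O(|sin y|
e^{-αn^r}) (`abs_errKernel_sub_le`).

The normalized coefficients of that series are convex and decrease slowly, on the scale δ =
αr/n^{1-r}. For |u| ≤ δ the sum of the coefficients bounds the series by 3/δ, which contributes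
O(1). For δ ≤ |u| ≤ π two Abel summations replace the series by a fast cosine divided by 2 sin(u/2).
Since |sin| has mean 2/π, each side gives (2/π) log(1/δ) + O(1) (`abs_integral_abs_tsum_sub_le`).

The upper bound follows by replacing φ with φ - T and taking the infimum over T. For the equality, a
continuous function close to sign `K` is forced to alternate at 2n equispaced points; this fixes its
best approximation exactly (`bestC_eq_of_alternation`) and costs arbitrarily little in the integral
(`exists_alternating_near_sign`). All absolute constants stay far below the required ones. -/

/-! ### Discrete orthogonality and aliasing: interpolation of one harmonic. -/

theorem sum_cos_equispaced {M : ℕ} (p : ℤ) (d : ℝ) (h : Real.sin (p * π / M) ≠ 0) :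
    ∑ i ∈ Finset.range M, Real.cos (p * (2 * i * π / M) + d) = 0 := by
  have hM : (M : ℝ) ≠ 0 := by
    intro h0; simp [h0] at h
  -- Multiplication by twice the sine of the half step makes the sum telescope.
  have key : ∀ m : ℕ, 2 * Real.sin (p * π / M) *
      ∑ i ∈ Finset.range m, Real.cos (p * (2 * i * π / M) + d) =
      Real.sin (p * (2 * m * π / M) + d - p * π / M) - Real.sin (d - p * π / M) := by
    intro m
    induction m with
    | zero => simp
    | succ m ih =>
      rw [Finset.sum_range_succ, mul_add, ih]
      have e : (p : ℝ) * (2 * ((m + 1 : ℕ) : ℝ) * π / M) + d - p * π / M =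
        (p * (2 * m * π / M) + d) + p * π / M := by push_cast; ring
      rw [e, Real.sin_add, Real.sin_sub]; ring
  have h2 := key M
  have e : (p : ℝ) * (2 * M * π / M) + d - p * π / M = d - p * π / M + p * (2 * π) := by
    field_simp; ring
  rw [e, Real.sin_add_int_mul_two_pi, sub_self] at h2
  rcases mul_eq_zero.1 h2 with h3 | h3
  · exact absurd (by linarith) h
  · exact h3

theorem sin_int_mul_pi_div_ne_zero {M : ℕ} {p : ℤ} (h0 : p ≠ 0) (h1 : |p| < M) :
    Real.sin (p * π / M) ≠ 0 := by
  intro h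
  obtain ⟨m, hm⟩ := Real.sin_eq_zero_iff.1 h
  have hM : (0 : ℤ) < M := lt_of_le_of_lt (abs_nonneg p) h1
  have hM' : (M : ℝ) ≠ 0 := by exact_mod_cast hM.ne'
  have hp := Real.pi_pos.ne'
  have h2 : (m : ℝ) * M = p := by
    field_simp at hm
    linarith
  have h3 : m * M = p := by exact_mod_cast h2
  have hm0 : m ≠ 0 := by rintro rfl; simp at h3; exact h0 h3.symm
  rw [← h3, abs_mul, abs_of_pos hM] at h1
  have := Int.one_le_abs hm0
  nlinarith

theorem node_eq {n : ℕ} (hn : 1 ≤ n) (i : ℕ) : node n i = 2 * i * π / (2 * n - 1 : ℕ) := by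
  unfold node
  rw [Nat.cast_sub (by omega)]; push_cast; rfl

/-- The product splits into the frequencies j - l and j + l, both smaller than 2n-1 in absolute
value, so a sum over the nodes survives only at frequency zero; both are zero only when j = l = 0.
-/
theorem sum_cos_node_mul_cos {n : ℕ} (hn : 1 ≤ n) {j l : ℕ} (hj : j < n) (hl : l < n) (c x : ℝ) :
    ∑ i ∈ Finset.range (2 * n - 1), Real.cos (j * node n i + c) * Real.cos (l * (x - node n i)) =
      if j = l then (if l = 0 then 1 else 1 / 2) * (2 * n - 1) * Real.cos (j * x + c) else 0 := by
  have hprod : ∀ i : ℕ, Real.cos (j * node n i + c) * Real.cos (l * (x - node n i)) =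
      1 / 2 * Real.cos (((j - l : ℤ) : ℝ) * (2 * i * π / (2 * n - 1 : ℕ)) + (l * x + c)) +
      1 / 2 * Real.cos (((j + l : ℤ) : ℝ) * (2 * i * π / (2 * n - 1 : ℕ)) + (c - l * x)) := by
    intro i
    rw [← node_eq hn]
    have e1 : ((j - l : ℤ) : ℝ) * node n i + (l * x + c) =
      (j * node n i + c) + (l * (x - node n i)) := by push_cast; ring
    have e2 : ((j + l : ℤ) : ℝ) * node n i + (c - l * x) =
      (j * node n i + c) - (l * (x - node n i)) := by push_cast; ring
    rw [e1, e2, Real.cos_add (j * node n i + c), Real.cos_sub (j * node n i + c)]; ring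
  simp only [hprod, Finset.sum_add_distrib, ← Finset.mul_sum]
  have hN : ((2 * n - 1 : ℕ) : ℝ) = 2 * n - 1 := by
    rw [Nat.cast_sub (by omega)]; push_cast; rfl
  split_ifs with h1 h2
  · subst h1; subst h2; simp [hN]; ring
  · subst h1
    rw [sum_cos_equispaced ((j : ℤ) + j) _ (sin_int_mul_pi_div_ne_zero (by omega)
      (by rw [abs_lt]; omega))]
    simp [hN]
    ring
  · rw [sum_cos_equispaced ((j : ℤ) + l) _ (sin_int_mul_pi_div_ne_zero (by omega)
      (by rw [abs_lt]; omega)), sum_cos_equispaced ((j : ℤ) - l) _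
      (sin_int_mul_pi_div_ne_zero (by omega) (by rw [abs_lt]; omega))]
    simp

theorem interp_cos {n : ℕ} {j : ℕ} (hj : j < n) (c x : ℝ) :
    interp n (fun y => Real.cos (j * y + c)) x = Real.cos (j * x + c) := by
  have hn : 1 ≤ n := by omega
  have hN : (2 * (n : ℝ) - 1) ≠ 0 := by
    have : (1 : ℝ) ≤ n := by exact_mod_cast hn
    linarith
  have hD : ∀ t : ℝ, dirichlet n t = ∑ l ∈ Finset.range n,
      (if l = 0 then 1 / 2 else 1) * Real.cos (l * t) := by
    intro t
    rw [Finset.range_eq_Ico, Finset.sum_eq_sum_Ico_succ_bot (by omega), dirichlet]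
    congr 1
    · simp
    · refine Finset.sum_congr rfl fun k hk => ?_
      have : k ≠ 0 := by have := (Finset.mem_Ico.1 hk).1; omega
      simp [this]
  have hsum : ∑ i ∈ Finset.range (2 * n - 1),
      Real.cos (j * node n i + c) * dirichlet n (x - node n i) =
      (2 * n - 1) / 2 * Real.cos (j * x + c) := by
    simp only [hD, Finset.mul_sum]
    rw [Finset.sum_comm]
    have : ∀ l ∈ Finset.range n, (∑ i ∈ Finset.range (2 * n - 1), Real.cos (j * node n i + c) *
        ((if l = 0 then 1 / 2 else 1) * Real.cos (l * (x - node n i)))) =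
        if j = l then (2 * n - 1) / 2 * Real.cos (j * x + c) else 0 := by
      intro l hl
      have h := sum_cos_node_mul_cos hn hj (Finset.mem_range.1 hl) c x
      calc _ = (if l = 0 then 1 / 2 else 1) * ∑ i ∈ Finset.range (2 * n - 1),
            Real.cos (j * node n i + c) * Real.cos (l * (x - node n i)) := by
            rw [Finset.mul_sum]; exact Finset.sum_congr rfl fun i _ => by ring
        _ = _ := by
            rw [h]; split_ifs <;> ring
    rw [Finset.sum_congr rfl this, Finset.sum_ite_eq, if_pos (Finset.mem_range.2 hj)]
  rw [interp, hsum]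
  field_simp

/-- The phases k t and j t differ by a multiple of 2π at every node, so the two harmonics have the
same samples. -/
theorem interp_cos_of_alias {n : ℕ} {k m : ℕ} {j : ℤ}
    (hk : (k : ℤ) = m * (2 * n - 1) + j) (hj : |j| < n) (c x : ℝ) :
    interp n (fun y => Real.cos (k * y + c)) x = Real.cos (j * x + c) := by
  have hn : 1 ≤ n := by have := abs_nonneg j; omega
  have hN : (2 * (n : ℝ) - 1) ≠ 0 := by
    have : (1 : ℝ) ≤ n := by exact_mod_cast hn
    linarith
  have hk' : (k : ℝ) = m * (2 * n - 1) + j := by exact_mod_cast congrArg (Int.cast : ℤ → ℝ) hk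
  have h1 : interp n (fun y => Real.cos (k * y + c)) x =
      interp n (fun y => Real.cos (j * y + c)) x := by
    unfold interp
    congr 1
    refine Finset.sum_congr rfl fun i _ => ?_
    congr 1
    have : (k : ℝ) * node n i + c = j * node n i + c + ((m * i : ℤ) : ℝ) * (2 * π) := by
      rw [hk']; unfold node; push_cast; field_simp; ring
    simp only [this, Real.cos_add_int_mul_two_pi]
  rw [h1]
  rcases le_total 0 j with h | h
  · lift j to ℕ using h
    have := interp_cos (n := n) (j := j) (by rw [abs_lt] at hj; omega) c x
    simpa using this
  · obtain ⟨i, rfl⟩ : ∃ i : ℕ, j = -(i : ℤ) := ⟨(-j).toNat, by omega⟩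
    have := interp_cos (n := n) (j := i) (by rw [abs_lt] at hj; omega) (-c) x
    have e : ∀ y : ℝ, Real.cos (((-(i : ℤ) : ℤ) : ℝ) * y + c) = Real.cos (i * y + -c) := by
      intro y; rw [← Real.cos_neg]; push_cast; ring_nf
    simp only [e, this]

/-- The error at `x` of interpolating the harmonic `cos (k · + c)`. -/
def modeErr (n k : ℕ) (c x : ℝ) : ℝ :=
  Real.cos (k * x + c) - interp n (fun y => Real.cos (k * y + c)) x

theorem modeErr_of_lt {n k : ℕ} (h : k < n) (c x : ℝ) : modeErr n k c x = 0 := by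
  rw [modeErr, interp_cos h, sub_self]

theorem modeErr_of_alias {n : ℕ} {k m : ℕ} {j : ℤ}
    (hk : (k : ℤ) = m * (2 * n - 1) + j) (hj : |j| < n) (c x : ℝ) :
    modeErr n k c x = -2 * Real.sin (m * ((2 * n - 1) / 2 * x)) *
      Real.sin (k * x + c - m * ((2 * n - 1) / 2 * x)) := by
  have hk' : (k : ℝ) = m * (2 * n - 1) + j := by exact_mod_cast congrArg (Int.cast : ℤ → ℝ) hk
  have e1 : (k * x + c + (j * x + c)) / 2 = k * x + c - m * ((2 * n - 1) / 2 * x) := by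
    rw [hk']; ring
  have e2 : (k * x + c - (j * x + c)) / 2 = m * ((2 * n - 1) / 2 * x) := by
    rw [hk']; ring
  rw [modeErr, interp_cos_of_alias hk hj, Real.cos_sub_cos, e1, e2]
  ring

/-- This keeps the factor |sin y| in the error of every harmonic, whatever its alias index m. -/
theorem abs_sin_nat_mul_le (m : ℕ) (y : ℝ) : |Real.sin (m * y)| ≤ m * |Real.sin y| := by
  induction m with
  | zero => simp
  | succ m ih =>
    push_cast
    rw [add_mul, one_mul, Real.sin_add]
    calc _ ≤ |Real.sin (m * y) * Real.cos y| + |Real.cos (m * y) * Real.sin y| := abs_add_le _ _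
      _ ≤ |Real.sin (m * y)| * 1 + 1 * |Real.sin y| := by
        rw [abs_mul, abs_mul]
        gcongr
        · exact Real.abs_cos_le_one _
        · exact Real.abs_cos_le_one _
      _ ≤ _ := by linarith

theorem exists_alias {n k : ℕ} (hn : 1 ≤ n) (hk : 1 ≤ k) : ∃ (m : ℕ) (j : ℤ),
    (k : ℤ) = m * (2 * n - 1) + j ∧ |j| < n ∧ m ≤ k := by
  -- Adding n - 1 before dividing centres the remainder in [-(n-1), n-1].
  have h1 := Nat.div_add_mod (k + n - 1) (2 * n - 1)
  have h2 := Nat.mod_lt (k + n - 1) (show 2 * n - 1 > 0 by omega)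
  set m := (k + n - 1) / (2 * n - 1) with hm
  set q := (k + n - 1) % (2 * n - 1)
  refine ⟨m, (q : ℤ) - (n - 1), ?_, by rw [abs_lt]; omega, ?_⟩
  · zify [show 1 ≤ 2 * n by omega, show 1 ≤ k + n by omega] at h1
    linarith
  · rw [hm]
    refine Nat.div_le_of_le_mul ?_
    zify [show 1 ≤ 2 * n by omega, show 1 ≤ k + n by omega]
    have hn' : (1 : ℤ) ≤ n := by exact_mod_cast hn
    have : (1 : ℤ) ≤ k := by exact_mod_cast hk
    nlinarith

theorem modeErr_main {n k : ℕ} (h1 : n ≤ k) (h2 : k + 2 ≤ 3 * n) (c x : ℝ) :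
    modeErr n k c x = -2 * Real.sin ((2 * n - 1) / 2 * x) *
      Real.sin (k * x + c - (2 * n - 1) / 2 * x) := by
  have := modeErr_of_alias (n := n) (k := k) (m := 1) (j := k - (2 * n - 1)) (by push_cast; ring)
    (by rw [abs_lt]; omega) c x
  simpa using this

theorem abs_modeErr_le {n : ℕ} (hn : 1 ≤ n) (k : ℕ) (c x : ℝ) :
    |modeErr n k c x| ≤ 2 * k * |Real.sin ((2 * n - 1) / 2 * x)| := by
  rcases Nat.eq_zero_or_pos k with h0 | h0
  · rw [modeErr_of_lt (by omega)]; simp [h0]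
  obtain ⟨m, j, h1, h2, h3⟩ := exists_alias hn h0
  rw [modeErr_of_alias h1 h2, abs_mul, abs_mul]
  have h4 := abs_sin_nat_mul_le m ((2 * n - 1) / 2 * x)
  have h5 : |(-2 : ℝ)| = 2 := by norm_num
  have h6 : (m : ℝ) ≤ k := by exact_mod_cast h3
  rw [h5]
  calc _ ≤ 2 * |Real.sin (m * ((2 * n - 1) / 2 * x))| * 1 := by
        gcongr; exact Real.abs_sin_le_one _
    _ ≤ 2 * (m * |Real.sin ((2 * n - 1) / 2 * x)|) * 1 := by gcongr
    _ ≤ 2 * (k * |Real.sin ((2 * n - 1) / 2 * x)|) * 1 := by gcongr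
    _ = _ := by ring

/-! ### Mean value of a rapidly oscillating |sin| against 1 / (2 sin(u/2)). -/

theorem abs_sub_le_abs_add_abs (a b : ℝ) : |a - b| ≤ |a| + |b| := norm_sub_le a b

theorem integral_abs_sin_sub_period (u : ℝ) :
    ∫ v in u..(u + π), (|Real.sin v| - 2 / π) = 0 := by
  have hper : Function.Periodic (fun v : ℝ => |Real.sin v| - 2 / π) π := by
    intro v; simp [Real.sin_add_pi]
  rw [hper.intervalIntegral_add_eq u 0, zero_add]
  have : ∫ v in (0:ℝ)..π, (|Real.sin v| - 2 / π) = ∫ v in (0:ℝ)..π, (Real.sin v - 2 / π) := by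
    refine intervalIntegral.integral_congr fun v hv => ?_
    rw [Set.uIcc_of_le Real.pi_pos.le] at hv
    rw [abs_of_nonneg (Real.sin_nonneg_of_mem_Icc hv)]
  rw [this, intervalIntegral.integral_sub (Real.continuous_sin.intervalIntegrable _ _) (by simp)]
  simp [integral_sin]
  field_simp; norm_num

/-- The integrand has mean zero over its period, so its primitive from 0 is periodic, and it is
bounded by π because the integrand is at most 1 in absolute value. -/
theorem abs_integral_abs_sin_sub_le (a b : ℝ) :
    |∫ v in a..b, (|Real.sin v| - 2 / π)| ≤ 2 * π := by
  have hint : ∀ a b : ℝ, IntervalIntegrable (fun v : ℝ => |Real.sin v| - 2 / π) volume a b :=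
    fun a b => Continuous.intervalIntegrable (by fun_prop) a b
  have hper : Function.Periodic (fun u : ℝ => ∫ v in (0:ℝ)..u, (|Real.sin v| - 2 / π)) π := by
    intro u
    change ∫ v in (0:ℝ)..(u + π), (|Real.sin v| - 2 / π) = ∫ v in (0:ℝ)..u, (|Real.sin v| - 2 / π)
    rw [← intervalIntegral.integral_add_adjacent_intervals (hint 0 u) (hint u (u + π)),
      integral_abs_sin_sub_period, add_zero]
  have hbd : ∀ u : ℝ, |∫ v in (0:ℝ)..u, (|Real.sin v| - 2 / π)| ≤ π := by
    intro u
    obtain ⟨y, hy, hyu⟩ := hper.exists_mem_Ico₀ Real.pi_pos u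
    rw [hyu]
    have hb : ∀ v ∈ Set.uIoc 0 y, ‖|Real.sin v| - 2 / π‖ ≤ 1 := by
      intro v _
      rw [Real.norm_eq_abs, abs_le]
      have h1 := Real.abs_sin_le_one v
      have h2 := abs_nonneg (Real.sin v)
      have h3 : 2 / π ≤ 1 := by rw [div_le_one Real.pi_pos]; exact Real.two_le_pi
      have h4 : 0 ≤ 2 / π := by positivity
      constructor <;> linarith
    have := intervalIntegral.norm_integral_le_of_norm_le_const hb
    rw [Real.norm_eq_abs, sub_zero, one_mul, abs_of_nonneg hy.1] at this
    linarith [hy.2]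
  rw [← intervalIntegral.integral_interval_sub_left (hint 0 b) (hint 0 a)]
  calc _ ≤ _ := abs_sub_le_abs_add_abs _ _
    _ ≤ _ := by linarith [hbd a, hbd b]

theorem abs_integral_abs_sin_mul_add_sub_le {ν : ℝ} (hν : 0 < ν) (c a b : ℝ) :
    |∫ u in a..b, (|Real.sin (ν * u + c)| - 2 / π)| ≤ 2 * π / ν := by
  have := intervalIntegral.integral_comp_mul_add (a := a) (b := b)
    (fun v : ℝ => |Real.sin v| - 2 / π) hν.ne' c
  rw [this, smul_eq_mul, abs_mul, abs_of_pos (inv_pos.2 hν), div_eq_inv_mul (2 * π) ν]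
  gcongr
  exact abs_integral_abs_sin_sub_le _ _

theorem div_pi_le_sin_half {u : ℝ} (h0 : 0 ≤ u) (h1 : u ≤ π) : u / π ≤ Real.sin (u / 2) := by
  have := Real.mul_le_sin (x := u / 2) (by linarith) (by linarith)
  calc u / π = 2 / π * (u / 2) := by ring
    _ ≤ _ := this

theorem sin_half_pos {u : ℝ} (h0 : 0 < u) (h1 : u ≤ π) : 0 < Real.sin (u / 2) :=
  Real.sin_pos_of_pos_of_lt_pi (by linarith) (by linarith [Real.pi_pos])

theorem integral_inv_two_sin_half {δ : ℝ} (h0 : 0 < δ) (h1 : δ ≤ π) :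
    ∫ u in δ..π, (2 * Real.sin (u / 2))⁻¹ = -Real.log (Real.tan (δ / 4)) := by
  have hd : ∀ u ∈ Set.uIcc δ π, HasDerivAt (fun u => Real.log (Real.tan (u / 4)))
      ((2 * Real.sin (u / 2))⁻¹) u := by
    intro u hu
    rw [Set.uIcc_of_le h1] at hu
    have hs : 0 < Real.sin (u / 4) := Real.sin_pos_of_pos_of_lt_pi (by linarith [hu.1])
      (by linarith [Real.pi_pos, hu.2])
    have hc : 0 < Real.cos (u / 4) := Real.cos_pos_of_mem_Ioo
      ⟨by linarith [hu.1, Real.pi_pos], by linarith [Real.pi_pos, hu.2]⟩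
    have ht : Real.tan (u / 4) ≠ 0 := by
      rw [Real.tan_eq_sin_div_cos]; positivity
    have h := ((Real.hasDerivAt_tan hc.ne').comp u
      ((hasDerivAt_id u).div_const 4)).log (by simpa using ht)
    refine h.congr_deriv ?_
    have e : Real.sin (u / 2) = 2 * Real.sin (u / 4) * Real.cos (u / 4) := by
      rw [← Real.sin_two_mul]; ring_nf
    simp only [Function.comp, id]
    rw [e, Real.tan_eq_sin_div_cos]
    field_simp
    norm_num
  rw [intervalIntegral.integral_eq_sub_of_hasDerivAt hd]
  · simp
  · refine ContinuousOn.intervalIntegrable ?_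
    refine ContinuousOn.inv₀ (by fun_prop) fun u hu => ?_
    rw [Set.uIcc_of_le h1] at hu
    have := sin_half_pos (by linarith [hu.1]) hu.2
    positivity

/-- From δ/4 < tan(δ/4) ≤ δ the discrepancy is at most log 4. -/
theorem abs_neg_log_tan_sub_le {δ : ℝ} (h0 : 0 < δ) (h1 : δ ≤ 1) :
    |-Real.log (Real.tan (δ / 4)) - Real.log (1 / δ)| ≤ 2 := by
  have hlt : δ / 4 < Real.tan (δ / 4) := Real.lt_tan (by linarith) (by linarith [Real.pi_gt_three])
  have hgt : Real.tan (δ / 4) ≤ δ := by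
    have hc := Real.one_sub_sq_div_two_le_cos (x := δ / 4)
    have hc' : 1 / 4 ≤ Real.cos (δ / 4) := by nlinarith
    rw [Real.tan_eq_sin_div_cos, div_le_iff₀ (by linarith)]
    have := Real.sin_le (x := δ / 4) (by linarith)
    nlinarith
  have h4 : Real.log 4 ≤ 2 := by
    have : (4 : ℝ) = 2 ^ 2 := by norm_num
    rw [this, Real.log_pow]
    have := Real.log_two_lt_d9
    push_cast; linarith
  have e1 := Real.log_le_log (by positivity) hlt.le
  have e2 := Real.log_le_log (by linarith) hgt
  rw [Real.log_div h0.ne' (by norm_num)] at e1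
  rw [one_div, Real.log_inv, abs_le]
  constructor <;> linarith

/-- Integration by parts: the primitive `H` of |sin| - 2/π is O(1/ν), while the other factor is
monotone, so its total variation is the difference of its end values. -/
theorem abs_integral_abs_sin_div_sin_half_le {δ ν : ℝ} (h0 : 0 < δ) (h1 : δ ≤ 1) (hν : 0 < ν)
    (c : ℝ) :
    |(∫ u in δ..π, |Real.sin (ν * u + c)| * (2 * Real.sin (u / 2))⁻¹)
      - 2 / π * -Real.log (Real.tan (δ / 4))| ≤ π ^ 2 / (ν * δ) := by
  have hπ : δ ≤ π := by linarith [Real.pi_gt_three]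
  have hpos : ∀ u ∈ Set.uIcc δ π, 0 < Real.sin (u / 2) := by
    intro u hu
    rw [Set.uIcc_of_le hπ] at hu
    exact sin_half_pos (by linarith [hu.1]) hu.2
  have hgc : ContinuousOn (fun u => (2 * Real.sin (u / 2))⁻¹) (Set.uIcc δ π) :=
    ContinuousOn.inv₀ (by fun_prop) fun u hu => by have := hpos u hu; positivity
  set g' : ℝ → ℝ := fun u => -(Real.cos (u / 2)) / (2 * Real.sin (u / 2)) ^ 2
  have hgd : ∀ u ∈ Set.uIcc δ π, HasDerivAt (fun u => (2 * Real.sin (u / 2))⁻¹) (g' u) u := by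
    intro u hu
    have hs := hpos u hu
    have h := ((((Real.hasDerivAt_sin (u / 2)).comp u
      ((hasDerivAt_id u).div_const 2)).const_mul 2).inv (by simp; positivity))
    refine h.congr_deriv ?_
    simp only [g', Function.comp, id]
    ring
  have hg'c : ContinuousOn g' (Set.uIcc δ π) :=
    ContinuousOn.div (by fun_prop) (by fun_prop) fun u hu => by have := hpos u hu; positivity
  have hg'i : IntervalIntegrable g' volume δ π := hg'c.intervalIntegrable
  set h : ℝ → ℝ := fun u => |Real.sin (ν * u + c)| - 2 / π with hh
  have hhc : Continuous h := by fun_prop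
  set H : ℝ → ℝ := fun t => ∫ u in δ..t, h u with hH
  have hHd : ∀ u ∈ Set.uIcc δ π, HasDerivAt H (h u) u := fun u _ =>
    intervalIntegral.integral_hasDerivAt_right (hhc.intervalIntegrable _ _)
      hhc.aestronglyMeasurable.stronglyMeasurableAtFilter hhc.continuousAt
  have hparts := intervalIntegral.integral_deriv_mul_eq_sub_of_hasDeriv_right
    (u := H) (v := fun u => (2 * Real.sin (u / 2))⁻¹) (u' := h) (v' := g')
    (fun u hu => (hHd u hu).continuousAt.continuousWithinAt) hgc
    (fun u hu => (hHd u (Set.Ioo_subset_Icc_self hu)).hasDerivWithinAt)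
    (fun u hu => (hgd u (Set.Ioo_subset_Icc_self hu)).hasDerivWithinAt)
    (hhc.intervalIntegrable _ _) hg'i
  have hHc : ContinuousOn H (Set.uIcc δ π) :=
    fun u hu => (hHd u hu).continuousAt.continuousWithinAt
  have hHb : ∀ t, |H t| ≤ 2 * π / ν := fun t => abs_integral_abs_sin_mul_add_sub_le hν c δ t
  have hi1 : IntervalIntegrable (fun u => h u * (2 * Real.sin (u / 2))⁻¹) volume δ π :=
    (hhc.continuousOn.mul hgc).intervalIntegrable
  have hi2 : IntervalIntegrable (fun u => H u * g' u) volume δ π :=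
    (hHc.mul hg'c).intervalIntegrable
  rw [intervalIntegral.integral_add hi1 hi2] at hparts
  have hHδ : H δ = 0 := by simp [hH]
  rw [hHδ, zero_mul, sub_zero] at hparts
  have hg'int : ∫ u in δ..π, g' u = (2 * Real.sin (π / 2))⁻¹ - (2 * Real.sin (δ / 2))⁻¹ :=
    intervalIntegral.integral_eq_sub_of_hasDerivAt hgd hg'i
  have hHg : |∫ u in δ..π, H u * g' u| ≤ 2 * π / ν *
      ((2 * Real.sin (δ / 2))⁻¹ - (2 * Real.sin (π / 2))⁻¹) := by
    have : ‖∫ u in δ..π, H u * g' u‖ ≤ ∫ u in δ..π, 2 * π / ν * -g' u := by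
      refine intervalIntegral.norm_integral_le_of_norm_le hπ ?_ (hg'i.neg.const_mul _)
      refine Filter.Eventually.of_forall fun u hu => ?_
      have hneg : g' u ≤ 0 := by
        have : 0 ≤ Real.cos (u / 2) := Real.cos_nonneg_of_mem_Icc
          ⟨by linarith [hu.1, Real.pi_pos], by linarith [hu.2]⟩
        simp only [g']
        exact div_nonpos_of_nonpos_of_nonneg (by linarith) (by positivity)
      rw [norm_mul, Real.norm_eq_abs, Real.norm_eq_abs, abs_of_nonpos hneg]
      exact mul_le_mul_of_nonneg_right (hHb u) (by linarith)
    rw [intervalIntegral.integral_const_mul, intervalIntegral.integral_neg, hg'int] at this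
    simpa using this
  have hmain : ∫ u in δ..π, h u * (2 * Real.sin (u / 2))⁻¹ =
      (∫ u in δ..π, |Real.sin (ν * u + c)| * (2 * Real.sin (u / 2))⁻¹)
      - 2 / π * -Real.log (Real.tan (δ / 4)) := by
    rw [← integral_inv_two_sin_half h0 hπ, ← intervalIntegral.integral_const_mul,
      ← intervalIntegral.integral_sub]
    · exact intervalIntegral.integral_congr fun u _ => by simp only [hh]; ring
    · exact ContinuousOn.intervalIntegrable (ContinuousOn.mul (by fun_prop) hgc)
    · exact (hgc.intervalIntegrable).const_mul _
  rw [← hmain]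
  have e1 : ∫ u in δ..π, h u * (2 * Real.sin (u / 2))⁻¹ =
    H π * (2 * Real.sin (π / 2))⁻¹ - ∫ u in δ..π, H u * g' u := by linarith
  have hgδ : (2 * Real.sin (δ / 2))⁻¹ ≤ π / (2 * δ) := by
    have := div_pi_le_sin_half h0.le hπ
    have hd : 0 < δ / π := by positivity
    calc (2 * Real.sin (δ / 2))⁻¹ ≤ (2 * (δ / π))⁻¹ := by gcongr
      _ = _ := by field_simp
  have hgπ : 0 < (2 * Real.sin (π / 2))⁻¹ := by simp
  rw [e1]
  calc _ ≤ |H π * (2 * Real.sin (π / 2))⁻¹| + |∫ u in δ..π, H u * g' u| := abs_sub_le_abs_add_abs _ _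
    _ ≤ 2 * π / ν * (2 * Real.sin (π / 2))⁻¹ + 2 * π / ν *
      ((2 * Real.sin (δ / 2))⁻¹ - (2 * Real.sin (π / 2))⁻¹) := by
        rw [abs_mul, abs_of_pos hgπ]
        gcongr
        exact hHb π
    -- The boundary term at π cancels the end value at π in the variation.
    _ = 2 * π / ν * (2 * Real.sin (δ / 2))⁻¹ := by ring
    _ ≤ 2 * π / ν * (π / (2 * δ)) := by gcongr
    _ = _ := by field_simp

/-! ### Abel summation and the L¹ norm of sine series with convex coefficients. -/

theorem summable_mul_of_abs_le_one {b f : ℕ → ℝ} (hs : Summable b) (hb : ∀ k, 0 ≤ b k)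
    (hf : ∀ k, |f k| ≤ 1) : Summable fun k => b k * f k := by
  refine Summable.of_norm_bounded hs fun k => ?_
  rw [norm_mul, Real.norm_eq_abs, Real.norm_eq_abs, abs_of_nonneg (hb k)]
  exact mul_le_of_le_one_right (hb k) (hf k)

/-- Abel summation for series. -/
theorem tsum_mul_sub_succ {b f : ℕ → ℝ} (hs : Summable b) (hb : ∀ k, 0 ≤ b k)
    (hf : ∀ k, |f k| ≤ 1) :
    ∑' k, b k * (f k - f (k + 1)) = b 0 * f 0 - ∑' k, (b k - b (k + 1)) * f (k + 1) := by
  have h1 := summable_mul_of_abs_le_one hs hb hf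
  have h2 := summable_mul_of_abs_le_one hs hb (f := fun k => f (k + 1)) fun k => hf (k + 1)
  have h3 := (summable_nat_add_iff 1).2 h1
  simp only [mul_sub, sub_mul]
  rw [h1.tsum_sub h2, h2.tsum_sub h3, h1.tsum_eq_zero_add]
  ring

theorem hasSum_sub_succ {b : ℕ → ℝ} (hs : Summable b) :
    HasSum (fun k => b k - b (k + 1)) (b 0) := by
  have := (hs.sub ((summable_nat_add_iff 1).2 hs)).hasSum
  rwa [hs.tsum_sub ((summable_nat_add_iff 1).2 hs), hs.tsum_eq_zero_add, add_sub_cancel_right]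
    at this

theorem abs_tsum_mul_sub_succ_le {b f : ℕ → ℝ} (hs : Summable b) (hb : ∀ k, 0 ≤ b k)
    (hanti : Antitone b) (hf : ∀ k, |f k| ≤ 1) :
    |∑' k, b k * (f k - f (k + 1))| ≤ 2 * b 0 := by
  rw [tsum_mul_sub_succ hs hb hf]
  have h1 : |∑' k, (b k - b (k + 1)) * f (k + 1)| ≤ b 0 := by
    rw [← Real.norm_eq_abs]
    refine tsum_of_norm_bounded (hasSum_sub_succ hs) fun k => ?_
    have h := sub_nonneg.2 (hanti (Nat.le_succ k))
    rw [norm_mul, Real.norm_eq_abs, Real.norm_eq_abs, abs_of_nonneg h]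
    exact mul_le_of_le_one_right h (hf _)
  have h2 : |b 0 * f 0| ≤ b 0 := by
    rw [abs_mul, abs_of_nonneg (hb 0)]
    exact mul_le_of_le_one_right (hb 0) (hf 0)
  calc _ ≤ _ := abs_sub_le_abs_add_abs _ _
    _ ≤ _ := by linarith

/-- A sine series with convex coefficients is close to the sum with all coefficients
equal to the first one. -/
theorem abs_tsum_mul_sin_sub_le {b : ℕ → ℝ} (hs : Summable b) (hb : ∀ k, 0 ≤ b k)
    (hanti : Antitone b) (hconv : Antitone fun k => b k - b (k + 1)) (h0 : b 0 = 1)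
    {u : ℝ} (hu : 0 < Real.sin (u / 2)) (θ : ℝ) :
    |(∑' k : ℕ, b k * Real.sin (θ + k * u)) - Real.cos (θ - u / 2) * (2 * Real.sin (u / 2))⁻¹|
      ≤ (1 - b 1) / (2 * Real.sin (u / 2) ^ 2) := by
  set s := Real.sin (u / 2)
  -- First summation by parts: the differences of these cosines at half-integers are 2s times the
  -- sines of the series. The boundary term is the main term.
  have hA := tsum_mul_sub_succ hs hb (f := fun k : ℕ => Real.cos (θ + (k - 1 / 2) * u))
    fun k => Real.abs_cos_le_one _
  have hs' : Summable fun k => b k - b (k + 1) := (hasSum_sub_succ hs).summable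
  -- Second summation by parts, for the coefficients b k - b (k+1): convexity makes them decreasing,
  -- so the remainder is governed by the first one, 1 - b 1.
  have hB := abs_tsum_mul_sub_succ_le hs' (fun k => sub_nonneg.2 (hanti (Nat.le_succ k))) hconv
    (f := fun k : ℕ => Real.sin (θ + k * u)) fun k => Real.abs_sin_le_one _
  have e1 : ∀ k : ℕ, Real.cos (θ + (k - 1 / 2) * u) -
      Real.cos (θ + (((k + 1 : ℕ) : ℝ) - 1 / 2) * u) = 2 * s * Real.sin (θ + k * u) := by
    intro k
    have a1 : θ + ((k : ℝ) - 1 / 2) * u = (θ + k * u) - u / 2 := by ring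
    have a2 : θ + (((k + 1 : ℕ) : ℝ) - 1 / 2) * u = (θ + k * u) + u / 2 := by push_cast; ring
    rw [a1, a2, Real.cos_sub (θ + k * u), Real.cos_add (θ + k * u)]; ring
  have e2 : ∀ k : ℕ, Real.sin (θ + k * u) - Real.sin (θ + ((k + 1 : ℕ) : ℝ) * u) =
      -(2 * s) * Real.cos (θ + (((k + 1 : ℕ) : ℝ) - 1 / 2) * u) := by
    intro k
    have a1 : θ + (k : ℝ) * u = (θ + (k + 1 / 2) * u) - u / 2 := by ring
    have a2 : θ + ((k + 1 : ℕ) : ℝ) * u = (θ + (k + 1 / 2) * u) + u / 2 := by push_cast; ring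
    have a3 : θ + (((k + 1 : ℕ) : ℝ) - 1 / 2) * u = θ + (k + 1 / 2) * u := by push_cast; ring
    rw [a1, a2, a3, Real.sin_sub (θ + (k + 1 / 2) * u), Real.sin_add (θ + (k + 1 / 2) * u)]; ring
  simp only [e1] at hA
  simp only [e2] at hB
  have e3 : ∑' k : ℕ, b k * (2 * s * Real.sin (θ + k * u)) =
      2 * s * ∑' k : ℕ, b k * Real.sin (θ + k * u) := by
    rw [← tsum_mul_left]; exact tsum_congr fun k => by ring
  have e4 : ∑' k : ℕ, (b k - b (k + 1)) * (-(2 * s) *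
      Real.cos (θ + (((k + 1 : ℕ) : ℝ) - 1 / 2) * u)) = -(2 * s) *
      ∑' k : ℕ, (b k - b (k + 1)) * Real.cos (θ + (((k + 1 : ℕ) : ℝ) - 1 / 2) * u) := by
    rw [← tsum_mul_left]; exact tsum_congr fun k => by ring
  rw [e3, h0] at hA
  rw [e4, abs_mul, abs_neg, abs_of_pos (by positivity : 0 < 2 * s), h0] at hB
  set X := ∑' k : ℕ, (b k - b (k + 1)) * Real.cos (θ + (((k + 1 : ℕ) : ℝ) - 1 / 2) * u)
  have e5 : (∑' k : ℕ, b k * Real.sin (θ + k * u)) - Real.cos (θ - u / 2) * (2 * s)⁻¹ =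
      -X / (2 * s) := by
    have a0 : θ + (((0 : ℕ) : ℝ) - 1 / 2) * u = θ - u / 2 := by push_cast; ring
    rw [a0] at hA
    rw [eq_div_iff (by positivity), sub_mul, mul_assoc, inv_mul_cancel₀ (by positivity)]
    linarith
  rw [e5, abs_div, abs_neg, abs_of_pos (by positivity : 0 < 2 * s),
    div_le_div_iff₀ (by positivity) (by positivity)]
  simp only [zero_add] at hB
  nlinarith

theorem continuous_tsum_mul_sin {b : ℕ → ℝ} (hs : Summable b) (hb : ∀ k, 0 ≤ b k) (n : ℕ) (c : ℝ) :
    Continuous fun u : ℝ => ∑' k : ℕ, b k * Real.sin ((n + k) * u + c) := by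
  refine continuous_tsum (fun k => by fun_prop) hs fun k u => ?_
  rw [norm_mul, Real.norm_eq_abs, Real.norm_eq_abs, abs_of_nonneg (hb k)]
  exact mul_le_of_le_one_right (hb k) (Real.abs_sin_le_one _)

theorem integral_inv_sq_le {δ : ℝ} (h0 : 0 < δ) (h1 : δ ≤ π) :
    ∫ u in δ..π, 1 / u ^ 2 ≤ 1 / δ := by
  have hd : ∀ u ∈ Set.uIcc δ π, HasDerivAt (fun u : ℝ => -u⁻¹) (1 / u ^ 2) u := by
    intro u hu
    rw [Set.uIcc_of_le h1] at hu
    have hu0 : u ≠ 0 := by linarith [hu.1]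
    refine (hasDerivAt_inv hu0).neg.congr_deriv ?_
    field_simp
  rw [intervalIntegral.integral_eq_sub_of_hasDerivAt hd]
  · have : 0 < π⁻¹ := by positivity
    rw [one_div]; linarith
  · refine ContinuousOn.intervalIntegrable (ContinuousOn.div (by fun_prop) (by fun_prop) ?_)
    intro u hu
    rw [Set.uIcc_of_le h1] at hu
    have hu0 : u ≠ 0 := by linarith [hu.1]
    positivity

/-- Beyond δ the replacement error is O(δ/u²), whose integral is O(1); the frequency n - 1/2 exceeds
1/δ, so the oscillation error is O(1) too. -/
theorem abs_integral_abs_tsum_half_le {b : ℕ → ℝ} (hs : Summable b) (hb : ∀ k, 0 ≤ b k)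
    (hanti : Antitone b) (hconv : Antitone fun k => b k - b (k + 1)) (h0 : b 0 = 1)
    {δ : ℝ} (hδ0 : 0 < δ) (hδ1 : δ ≤ 1) (hb1 : 1 - b 1 ≤ δ) {n : ℕ} (hn : 1 ≤ (n - 1 / 2) * δ)
    (c : ℝ) :
    |(∫ u in δ..π, |∑' k : ℕ, b k * Real.sin ((n + k) * u + c)|) - 2 / π * Real.log (1 / δ)|
      ≤ 18 := by
  have hπ : δ ≤ π := by linarith [Real.pi_gt_three]
  have hν : 0 < (n : ℝ) - 1 / 2 := by
    by_contra h
    nlinarith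
  have hpos : ∀ u ∈ Set.Icc δ π, 0 < Real.sin (u / 2) := fun u hu =>
    sin_half_pos (by linarith [hu.1]) hu.2
  have hFc := continuous_tsum_mul_sin hs hb n c
  set F : ℝ → ℝ := fun u : ℝ => ∑' k : ℕ, b k * Real.sin ((n + k) * u + c)
  have hgc : ContinuousOn (fun u => |Real.sin ((n - 1 / 2) * u + (c + π / 2))| *
      (2 * Real.sin (u / 2))⁻¹) (Set.uIcc δ π) :=
    ContinuousOn.mul (by fun_prop) (ContinuousOn.inv₀ (by fun_prop) fun u hu => by
      rw [Set.uIcc_of_le hπ] at hu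
      have := hpos u hu; positivity)
  have hpt : ∀ u ∈ Set.Icc δ π, |(|F u| - |Real.sin ((n - 1 / 2) * u + (c + π / 2))| *
      (2 * Real.sin (u / 2))⁻¹)| ≤ δ * π ^ 2 / 2 * (1 / u ^ 2) := by
    intro u hu
    have hs0 := hpos u hu
    have hu0 : 0 < u := by linarith [hu.1]
    have h1 := abs_tsum_mul_sin_sub_le hs hb hanti hconv h0 hs0 (n * u + c)
    have e1 : ∑' k : ℕ, b k * Real.sin (n * u + c + k * u) = F u :=
      tsum_congr fun k => by ring_nf
    have e2 : Real.cos (n * u + c - u / 2) = Real.sin ((n - 1 / 2) * u + (c + π / 2)) := by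
      rw [← add_assoc, Real.sin_add_pi_div_two]; ring_nf
    rw [e1, e2] at h1
    have h2 : |Real.sin ((n - 1 / 2) * u + (c + π / 2))| * (2 * Real.sin (u / 2))⁻¹ =
        |Real.sin ((n - 1 / 2) * u + (c + π / 2)) * (2 * Real.sin (u / 2))⁻¹| := by
      rw [abs_mul, abs_of_pos (a := (2 * Real.sin (u / 2))⁻¹) (by positivity)]
    rw [h2]
    refine (abs_abs_sub_abs_le _ _).trans (h1.trans ?_)
    have h3 := div_pi_le_sin_half hu0.le hu.2
    have h4 : 0 < u / π := by positivity
    calc (1 - b 1) / (2 * Real.sin (u / 2) ^ 2) ≤ δ / (2 * (u / π) ^ 2) := by gcongr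
      _ = _ := by field_simp
  have hFi : IntervalIntegrable (fun u => |F u|) volume δ π := hFc.abs.intervalIntegrable _ _
  have hqi : IntervalIntegrable (fun u : ℝ => δ * π ^ 2 / 2 * (1 / u ^ 2)) volume δ π := by
    refine ContinuousOn.intervalIntegrable (ContinuousOn.mul (by fun_prop)
      (ContinuousOn.div (by fun_prop) (by fun_prop) ?_))
    intro u hu
    rw [Set.uIcc_of_le hπ] at hu
    have hu0 : u ≠ 0 := by linarith [hu.1]
    positivity
  have h1 : |(∫ u in δ..π, |F u|) - ∫ u in δ..π, |Real.sin ((n - 1 / 2) * u + (c + π / 2))| *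
      (2 * Real.sin (u / 2))⁻¹| ≤ π ^ 2 / 2 := by
    rw [← intervalIntegral.integral_sub hFi hgc.intervalIntegrable]
    calc _ ≤ ∫ u in δ..π, δ * π ^ 2 / 2 * (1 / u ^ 2) := by
          rw [← Real.norm_eq_abs]
          refine intervalIntegral.norm_integral_le_of_norm_le hπ ?_ hqi
          exact Filter.Eventually.of_forall fun u hu => hpt u (Set.Ioc_subset_Icc_self hu)
      _ ≤ δ * π ^ 2 / 2 * (1 / δ) := by
          rw [intervalIntegral.integral_const_mul]
          gcongr
          exact integral_inv_sq_le hδ0 hπ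
      _ = _ := by field_simp
  have h2 := abs_integral_abs_sin_div_sin_half_le hδ0 hδ1 hν (c + π / 2)
  have h3 := abs_neg_log_tan_sub_le hδ0 hδ1
  have h4 : π ^ 2 / ((n - 1 / 2) * δ) ≤ π ^ 2 := div_le_self (by positivity) hn
  have h5 : |2 / π * -Real.log (Real.tan (δ / 4)) - 2 / π * Real.log (1 / δ)| ≤ 2 := by
    rw [← mul_sub, abs_mul, abs_of_pos (by positivity)]
    have : 2 / π ≤ 1 := by rw [div_le_one Real.pi_pos]; exact Real.two_le_pi
    calc _ ≤ (1 : ℝ) * 2 := by gcongr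
      _ = 2 := one_mul 2
  -- The errors add up to π²/2 + π² + 2 < 18: replacement of the series, oscillation, and log tan
  -- against log(1/δ).
  have h6 : π ^ 2 < 10 := by nlinarith [Real.pi_lt_d2, Real.pi_pos]
  rw [abs_le] at *
  constructor <;> linarith [h1.1, h1.2, h2.1, h2.2, h5.1, h5.2]

/-- The `L¹` norm over a period of a high-frequency sine series with slowly decaying convex
coefficients. -/
theorem abs_integral_abs_tsum_sub_le {b : ℕ → ℝ} (hs : Summable b) (hb : ∀ k, 0 ≤ b k)
    (hanti : Antitone b) (hconv : Antitone fun k => b k - b (k + 1)) (h0 : b 0 = 1)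
    {δ : ℝ} (hδ0 : 0 < δ) (hδ1 : δ ≤ 1) (hb1 : 1 - b 1 ≤ δ) (hsum : ∑' k, b k ≤ 3 / δ)
    {n : ℕ} (hn : 1 ≤ (n - 1 / 2) * δ) (c : ℝ) :
    |(∫ u in (-π)..π, |∑' k : ℕ, b k * Real.sin ((n + k) * u + c)|) - 4 / π * Real.log (1 / δ)|
      ≤ 42 := by
  have hFc := continuous_tsum_mul_sin hs hb n
  have hi : ∀ c a a' : ℝ, IntervalIntegrable
      (fun u : ℝ => |∑' k : ℕ, b k * Real.sin ((n + k) * u + c)|) volume a a' :=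
    fun c a a' => (hFc c).abs.intervalIntegrable _ _
  have h1 := abs_integral_abs_tsum_half_le hs hb hanti hconv h0 hδ0 hδ1 hb1 hn c
  have h2 := abs_integral_abs_tsum_half_le hs hb hanti hconv h0 hδ0 hδ1 hb1 hn (-c)
  -- Reflection turns the negative side into the positive one with phase -c.
  have e2 : ∫ u in (-π)..(-δ), |∑' k : ℕ, b k * Real.sin ((n + k) * u + c)| =
      ∫ u in δ..π, |∑' k : ℕ, b k * Real.sin ((n + k) * u + -c)| := by
    rw [← intervalIntegral.integral_comp_neg]
    refine intervalIntegral.integral_congr fun u _ => ?_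
    rw [← abs_neg, ← tsum_neg]
    congr 1
    refine tsum_congr fun k => ?_
    rw [← mul_neg, ← Real.sin_neg]
    ring_nf
  -- The bound 3/δ on an interval of length 2δ; then 42 = 18 + 18 + 6.
  have h3 : |(∫ u in (-δ)..δ, |∑' k : ℕ, b k * Real.sin ((n + k) * u + c)|)| ≤ 6 := by
    have := intervalIntegral.norm_integral_le_of_norm_le_const (a := -δ) (b := δ) (C := 3 / δ)
      (f := fun u : ℝ => |∑' k : ℕ, b k * Real.sin ((n + k) * u + c)|) (fun u _ => by
        rw [Real.norm_eq_abs, abs_abs, ← Real.norm_eq_abs]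
        refine (tsum_of_norm_bounded hs.hasSum fun k => ?_).trans hsum
        rw [norm_mul, Real.norm_eq_abs, Real.norm_eq_abs, abs_of_nonneg (hb k)]
        exact mul_le_of_le_one_right (hb k) (Real.abs_sin_le_one _))
    rw [Real.norm_eq_abs] at this
    refine this.trans (le_of_eq ?_)
    rw [sub_neg_eq_add, abs_of_pos (by linarith)]
    field_simp; norm_num
  rw [← intervalIntegral.integral_add_adjacent_intervals (hi c (-π) (-δ)) (hi c (-δ) π),
    ← intervalIntegral.integral_add_adjacent_intervals (hi c (-δ) δ) (hi c δ π), e2]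
  have e4 : 4 / π * Real.log (1 / δ) = 2 / π * Real.log (1 / δ) + 2 / π * Real.log (1 / δ) := by
    ring
  rw [e4]
  rw [abs_le] at *
  constructor <;> linarith [h1.1, h1.2, h2.1, h2.2, h3.1, h3.2]

/-! ### Monotonicity, convexity and tail sums of the coefficients. -/

/-- The Fourier coefficient `e^{-α u^r}` of the kernel. -/
def weight (α r u : ℝ) : ℝ := Real.exp (-α * u ^ r)

theorem weight_pos (α r u : ℝ) : 0 < weight α r u := Real.exp_pos _

theorem weight_anti {α r : ℝ} (hα : 0 < α) (hr0 : 0 < r) {u v : ℝ} (hu : 0 ≤ u) (huv : u ≤ v) :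
    weight α r v ≤ weight α r u := by
  have := Real.rpow_le_rpow hu huv hr0.le
  exact Real.exp_le_exp.2 (by nlinarith)

/-- Midpoint convexity: u^r is concave, hence -α u^r is convex, and exp is convex and increasing. -/
theorem two_mul_weight_le {α r : ℝ} (hα : 0 < α) (hr0 : 0 < r) (hr1 : r < 1) {u : ℝ} (hu : 0 ≤ u) :
    2 * weight α r (u + 1) ≤ weight α r u + weight α r (u + 2) := by
  have h0 : (0 : ℝ) ≤ 1 / 2 := by norm_num
  have hu2 : u + 2 ∈ Set.Ici (0 : ℝ) := by simp only [Set.mem_Ici]; linarith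
  have h1 := (Real.concaveOn_rpow hr0.le hr1.le).2 hu hu2 h0 h0 (by norm_num)
  have h2 := convexOn_exp.2 (Set.mem_univ (-α * u ^ r)) (Set.mem_univ (-α * (u + 2) ^ r))
    h0 h0 (by norm_num)
  simp only [smul_eq_mul] at h1 h2
  have e : 1 / 2 * u + 1 / 2 * (u + 2) = u + 1 := by ring
  rw [e] at h1
  have h3 : weight α r (u + 1) ≤ Real.exp (1 / 2 * (-α * u ^ r) + 1 / 2 * (-α * (u + 2) ^ r)) :=
    Real.exp_le_exp.2 (by nlinarith)
  unfold weight at *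
  linarith

/-- Since (v/u)^r = exp(r log(v/u)) ≥ 1 + r log(v/u), the coefficients beyond u decay at least like
the power of exponent α r u^r; tail sums then reduce to sums of powers. -/
theorem weight_le_mul_rpow {α r : ℝ} (hα : 0 < α) {u v : ℝ} (hu : 0 < u)
    (hv : 0 < v) : weight α r v ≤ weight α r u * (u / v) ^ (α * r * u ^ r) := by
  have h1 : v ^ r = u ^ r * Real.exp (r * Real.log (v / u)) := by
    have : v = u * (v / u) := by field_simp
    nth_rewrite 1 [this]
    rw [Real.mul_rpow hu.le (by positivity), Real.rpow_def_of_pos (x := v / u) (by positivity),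
      mul_comm r]
  have h2 := Real.add_one_le_exp (r * Real.log (v / u))
  have hur : 0 < u ^ r := Real.rpow_pos_of_pos hu r
  have h3 : Real.log (u / v) = -Real.log (v / u) := by rw [← Real.log_inv, inv_div]
  rw [Real.rpow_def_of_pos (x := u / v) (by positivity), weight, weight, ← Real.exp_add,
    Real.exp_le_exp, h3, h1]
  have h4 := mul_le_mul_of_nonneg_left h2 (mul_pos hα hur).le
  linarith

/-- A telescoping substitute for comparison with an integral, from Bernoulli's inequality for (1 +
1/m)^(s-1). -/
theorem add_one_rpow_neg_le {s m : ℝ} (hs : 2 ≤ s) (hm : 0 < m) :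
    (m + 1) ^ (-s) ≤ (m ^ (-(s - 1)) - (m + 1) ^ (-(s - 1))) / (s - 1) := by
  have h1 := one_add_mul_self_le_rpow_one_add (s := 1 / m) (p := s - 1)
    (by have : 0 < 1 / m := by positivity
        linarith) (by linarith)
  have hm1 : 0 < m + 1 := by linarith
  have h2 : m ^ (-(s - 1)) = (m + 1) ^ (-(s - 1)) * (1 + 1 / m) ^ (s - 1) := by
    have : 1 + 1 / m = (m + 1) / m := by field_simp
    rw [this, Real.div_rpow hm1.le hm.le, Real.rpow_neg hm.le, Real.rpow_neg hm1.le]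
    field_simp
  have h3 : (m + 1) ^ (-s) = (m + 1) ^ (-(s - 1)) * (1 / (m + 1)) := by
    rw [one_div, ← Real.rpow_neg_one (m + 1), ← Real.rpow_add hm1]
    congr 1; ring
  have hp : 0 < (m + 1) ^ (-(s - 1)) := Real.rpow_pos_of_pos hm1 _
  rw [le_div_iff₀ (by linarith), h2, h3]
  have h4 : 1 / (m + 1) ≤ 1 / m := by gcongr; linarith
  have h5 : 1 / (m + 1) * (s - 1) ≤ (1 + 1 / m) ^ (s - 1) - 1 := by nlinarith
  nlinarith

theorem summable_and_tsum_rpow_neg_le {s m : ℝ} (hs : 2 ≤ s) (hm : 0 < m) :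
    Summable (fun k : ℕ => (m + 1 + k) ^ (-s)) ∧
      ∑' k : ℕ, (m + 1 + k) ^ (-s) ≤ m ^ (-(s - 1)) / (s - 1) := by
  have hnn : ∀ k : ℕ, 0 ≤ (m + 1 + k) ^ (-s) := fun k => by positivity
  have hpart : ∀ j : ℕ, ∑ k ∈ Finset.range j, (m + 1 + k) ^ (-s) ≤ m ^ (-(s - 1)) / (s - 1) := by
    intro j
    have : ∑ k ∈ Finset.range j, (m + 1 + k) ^ (-s) ≤
        (m ^ (-(s - 1)) - (m + j) ^ (-(s - 1))) / (s - 1) := by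
      induction j with
      | zero => simp
      | succ j ih =>
        rw [Finset.sum_range_succ]
        have h := add_one_rpow_neg_le (s := s) (m := m + j) hs (by positivity)
        have e1 : m + 1 + (j : ℝ) = m + j + 1 := by ring
        have e2 : m + ((j + 1 : ℕ) : ℝ) = m + j + 1 := by push_cast; ring
        rw [e1, e2]
        calc _ ≤ _ := add_le_add ih h
          _ = _ := by ring
    refine this.trans ?_
    have h0 : 0 ≤ (m + j) ^ (-(s - 1)) := by positivity
    have h1 : 0 < s - 1 := by linarith
    gcongr
    linarith
  exact ⟨summable_of_sum_range_le hnn hpart, Real.tsum_le_of_sum_range_le hnn hpart⟩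

section

variable {α r : ℝ} {n : ℕ}

theorem weight_nat_le (hα : 0 < α) (hn : 1 ≤ n) {k : ℕ} (hk : 1 ≤ k) :
    weight α r k ≤ weight α r n * (n : ℝ) ^ (α * r * (n : ℝ) ^ r) *
      (k : ℝ) ^ (-(α * r * (n : ℝ) ^ r)) := by
  have hn' : (0 : ℝ) < n := by exact_mod_cast hn
  have hk' : (0 : ℝ) < k := by exact_mod_cast hk
  have := weight_le_mul_rpow (r := r) hα hn' hk'
  rwa [Real.div_rpow hn'.le hk'.le, div_eq_mul_inv, ← Real.rpow_neg hk'.le, ← mul_assoc] at this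

theorem summable_and_tsum_weight_le (hα : 0 < α) (hn : 1 ≤ n)
    (hA : 2 ≤ α * r * (n : ℝ) ^ r) :
    Summable (fun k : ℕ => weight α r (n + k)) ∧
      ∑' k : ℕ, weight α r (n + k) ≤ weight α r n * (1 + 2 * n / (α * r * (n : ℝ) ^ r)) := by
  set A := α * r * (n : ℝ) ^ r with hAdef
  have hn' : (0 : ℝ) < n := by exact_mod_cast hn
  obtain ⟨h1, h2⟩ := summable_and_tsum_rpow_neg_le hA hn'
  have hle : ∀ k : ℕ, weight α r (n + ((k + 1 : ℕ) : ℝ)) ≤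
      weight α r n * (n : ℝ) ^ A * ((n : ℝ) + 1 + k) ^ (-A) := by
    intro k
    have := weight_nat_le (α := α) (r := r) hα hn (k := n + 1 + k) (by omega)
    rw [← hAdef] at this
    push_cast at this ⊢
    have e : (n : ℝ) + (k + 1) = n + 1 + k := by ring
    rwa [e]
  have hs' : Summable fun k : ℕ => weight α r (n + ((k + 1 : ℕ) : ℝ)) :=
    Summable.of_nonneg_of_le (fun k => (weight_pos _ _ _).le) hle (h1.mul_left _)
  have hs : Summable fun k : ℕ => weight α r (n + k) :=
    (summable_nat_add_iff (f := fun k : ℕ => weight α r (n + k)) 1).1 hs'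
  refine ⟨hs, ?_⟩
  rw [hs.tsum_eq_zero_add]
  have h3 : ∑' k : ℕ, weight α r (n + ((k + 1 : ℕ) : ℝ)) ≤
      weight α r n * (n : ℝ) ^ A * ((n : ℝ) ^ (-(A - 1)) / (A - 1)) :=
    (hs'.tsum_le_tsum hle (h1.mul_left _)).trans (by
      rw [tsum_mul_left]
      have := weight_pos α r n
      gcongr)
  have h4 : (n : ℝ) ^ A * (n : ℝ) ^ (-(A - 1)) = n := by
    rw [← Real.rpow_add hn']
    have : A + -(A - 1) = 1 := by ring
    rw [this, Real.rpow_one]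
  have h5 : (n : ℝ) / (A - 1) ≤ 2 * n / A := by
    rw [div_le_div_iff₀ (by linarith) (by linarith)]
    nlinarith
  have h6 : weight α r n * (n : ℝ) ^ A * ((n : ℝ) ^ (-(A - 1)) / (A - 1)) =
      weight α r n * (n / (A - 1)) := by
    rw [mul_assoc, ← mul_div_assoc, h4]
  rw [h6] at h3
  simp only [Nat.cast_zero, add_zero]
  have := mul_le_mul_of_nonneg_left h5 (weight_pos α r n).le
  linarith

/-- The tail starts where the alias index leaves 1. There the frequency is at least 2n, which gains
2^{-(A-2)} with A = α r n^r; as A ≥ 6 log n, this beats the factor n² coming from the linear weight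
and the summation. -/
theorem summable_and_tsum_tail_le (hα : 0 < α) (hn : 2 ≤ n)
    (hA : 6 ≤ α * r * (n : ℝ) ^ r) (hA2 : 6 * Real.log n ≤ α * r * (n : ℝ) ^ r) :
    Summable (fun k : ℕ => ((3 * n - 1 + k : ℝ) + 1) * weight α r (3 * n - 1 + k)) ∧
      ∑' k : ℕ, ((3 * n - 1 + k : ℝ) + 1) * weight α r (3 * n - 1 + k) ≤ 2 * weight α r n := by
  set A := α * r * (n : ℝ) ^ r with hAdef
  have hn' : (2 : ℝ) ≤ n := by exact_mod_cast hn
  have hn0 : (0 : ℝ) < n := by linarith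
  obtain ⟨h1, h2⟩ := summable_and_tsum_rpow_neg_le (s := A - 1) (m := 3 * n - 2) (by linarith)
    (by linarith)
  have hle : ∀ k : ℕ, ((3 * n - 1 + k : ℝ) + 1) * weight α r (3 * n - 1 + k) ≤
      2 * weight α r n * (n : ℝ) ^ A * ((3 * (n : ℝ) - 2) + 1 + k) ^ (-(A - 1)) := by
    intro k
    have h := weight_nat_le (α := α) (r := r) hα (by omega : 1 ≤ n) (k := 3 * n - 1 + k) (by omega)
    have e : ((3 * n - 1 + k : ℕ) : ℝ) = 3 * n - 1 + k := by
      rw [Nat.cast_add, Nat.cast_sub (by omega)]; push_cast; ring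
    rw [← hAdef, e] at h
    have e2 : (3 * (n : ℝ) - 2) + 1 + k = 3 * n - 1 + k := by ring
    rw [e2]
    have hk : (0 : ℝ) ≤ k := Nat.cast_nonneg k
    set q : ℝ := 3 * n - 1 + k
    have hq : 1 ≤ q := by simp only [q]; linarith
    have e3 : q ^ (-(A - 1)) = q * q ^ (-A) := by
      rw [← Real.rpow_one_add' (by linarith) (by linarith)]
      congr 1; ring
    rw [e3]
    have hw := weight_pos α r q
    calc (q + 1) * weight α r q ≤ (2 * q) * weight α r q := by gcongr; linarith
      _ ≤ (2 * q) * (weight α r n * (n : ℝ) ^ A * q ^ (-A)) := by gcongr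
      _ = _ := by ring
  have hs : Summable (fun k : ℕ => ((3 * n - 1 + k : ℝ) + 1) * weight α r (3 * n - 1 + k)) := by
    refine Summable.of_nonneg_of_le (fun k => ?_) hle (h1.mul_left _)
    have hk : (0 : ℝ) ≤ k := Nat.cast_nonneg k
    exact mul_nonneg (by linarith) (weight_pos _ _ _).le
  refine ⟨hs, ?_⟩
  have hw := weight_pos α r n
  have h3 : ∑' k : ℕ, ((3 * n - 1 + k : ℝ) + 1) * weight α r (3 * n - 1 + k) ≤
      2 * weight α r n * (n : ℝ) ^ A * ((3 * (n : ℝ) - 2) ^ (-(A - 1 - 1)) / (A - 1 - 1)) :=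
    (hs.tsum_le_tsum hle (h1.mul_left _)).trans (by
      rw [tsum_mul_left]
      gcongr)
  refine h3.trans ?_
  have h4 : (3 * (n : ℝ) - 2) ^ (-(A - 1 - 1)) ≤ (2 * (n : ℝ)) ^ (-(A - 1 - 1)) :=
    Real.rpow_le_rpow_of_nonpos (by linarith) (by linarith) (by linarith)
  have h5 : (n : ℝ) ^ A * (2 * (n : ℝ)) ^ (-(A - 1 - 1)) = n ^ 2 * 2 ^ (-(A - 1 - 1)) := by
    rw [Real.mul_rpow (by norm_num) hn0.le, mul_left_comm, ← Real.rpow_add hn0]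
    have : A + -(A - 1 - 1) = (2 : ℕ) := by push_cast; ring
    rw [this, Real.rpow_natCast]; ring
  have h6 : (n : ℝ) ^ 2 * 2 ^ (-(A - 1 - 1)) ≤ 1 := by
    rw [Real.rpow_def_of_pos (by norm_num : (0:ℝ) < 2)]
    have e : (n : ℝ) ^ 2 = Real.exp (2 * Real.log n) := by
      rw [two_mul, Real.exp_add, Real.exp_log hn0]; ring
    rw [e, ← Real.exp_add, Real.exp_le_one_iff]
    have := Real.log_two_gt_d9
    nlinarith
  have h7 : (n : ℝ) ^ A * ((3 * (n : ℝ) - 2) ^ (-(A - 1 - 1)) / (A - 1 - 1)) ≤ 1 := by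
    have hnA : 0 < (n : ℝ) ^ A := Real.rpow_pos_of_pos hn0 _
    rw [← mul_div_assoc, div_le_one (by linarith)]
    nlinarith
  calc _ = 2 * weight α r n *
        ((n : ℝ) ^ A * ((3 * (n : ℝ) - 2) ^ (-(A - 1 - 1)) / (A - 1 - 1))) := by ring
    _ ≤ 2 * weight α r n * 1 := by gcongr
    _ = _ := by ring

theorem one_sub_weight_div_le (hα : 0 < α) (hr0 : 0 < r) (hr1 : r < 1) (hn : 1 ≤ n) :
    1 - weight α r (n + 1) / weight α r n ≤ α * r * (n : ℝ) ^ r / n := by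
  have hn' : (0 : ℝ) < n := by exact_mod_cast hn
  have h1 : ((n : ℝ) + 1) ^ r ≤ (n : ℝ) ^ r * (1 + r * (1 / n)) := by
    have e : (n : ℝ) + 1 = n * (1 + 1 / n) := by field_simp
    have hp : 0 < 1 / (n : ℝ) := by positivity
    rw [e, Real.mul_rpow hn'.le (by positivity)]
    gcongr
    exact rpow_one_add_le_one_add_mul_self (by linarith) hr0.le hr1.le
  rw [weight, weight, ← Real.exp_sub]
  have h2 := Real.add_one_le_exp (-α * ((n : ℝ) + 1) ^ r - -α * (n : ℝ) ^ r)
  have h3 := mul_le_mul_of_nonneg_left h1 hα.le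
  have e : α * ((n : ℝ) ^ r * (1 + r * (1 / n))) = α * (n : ℝ) ^ r + α * r * (n : ℝ) ^ r / n := by
    ring
  linarith

end

theorem abs_integral_abs_weight_series_sub_le {α r : ℝ} {n : ℕ} (hα : 0 < α) (hr0 : 0 < r)
    (hr1 : r < 1) (hn : 2 ≤ n) (hA : 2 ≤ α * r * (n : ℝ) ^ r) (hAn : α * r * (n : ℝ) ^ r ≤ n)
    (c : ℝ) :
    |(∫ u in (-π)..π, |∑' k : ℕ, weight α r (n + k) * Real.sin ((n + k) * u + c)|)
      - weight α r n * (4 / π * Real.log (n / (α * r * (n : ℝ) ^ r)))| ≤ 42 * weight α r n := by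
  have hn0 : (0 : ℝ) < n := by positivity
  have hn2 : (2 : ℝ) ≤ n := by exact_mod_cast hn
  have hw := weight_pos α r n
  obtain ⟨hs, hsum⟩ := summable_and_tsum_weight_le (r := r) hα (by omega : 1 ≤ n) hA
  -- The scale δ = α r n^r / n bounds the first relative drop of the coefficients, and their
  -- normalized sum is at most 1 + 2/δ ≤ 3/δ.
  have key := abs_integral_abs_tsum_sub_le (b := fun k : ℕ => weight α r (n + k) / weight α r n)
    (δ := α * r * (n : ℝ) ^ r / n) (n := n) (hs.div_const _)
    (fun k => div_nonneg (weight_pos _ _ _).le hw.le)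
    (antitone_nat_of_succ_le fun k => by
      have := weight_anti hα hr0 (u := (n : ℝ) + k) (v := n + ((k + 1 : ℕ) : ℝ)) (by positivity)
        (by push_cast; linarith)
      gcongr)
    (antitone_nat_of_succ_le fun k => by
      have := two_mul_weight_le hα hr0 hr1 (u := (n : ℝ) + k) (by positivity)
      simp only [← sub_div]
      have e1 : (n : ℝ) + ((k + 1 : ℕ) : ℝ) = n + k + 1 := by push_cast; ring
      have e2 : (n : ℝ) + ((k + 1 + 1 : ℕ) : ℝ) = n + k + 2 := by push_cast; ring
      rw [e1, e2]
      gcongr ?_ / _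
      linarith)
    (by simp [hw.ne']) (by positivity) (by rw [div_le_one hn0]; exact hAn)
    (by simpa using one_sub_weight_div_le hα hr0 hr1 (by omega : 1 ≤ n))
    (by
      rw [tsum_div_const, div_le_iff₀ hw]
      refine hsum.trans ?_
      have h1 : 1 ≤ n / (α * r * (n : ℝ) ^ r) := by
        rw [one_le_div (by linarith)]; exact hAn
      have h2 : 3 / (α * r * (n : ℝ) ^ r / n) = 3 * (n / (α * r * (n : ℝ) ^ r)) := by
        rw [div_div_eq_mul_div, mul_div_assoc]
      rw [h2, mul_div_assoc, mul_comm (weight α r n)]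
      gcongr
      linarith)
    (by
      rw [mul_div_assoc', le_div_iff₀ hn0]
      nlinarith) c
  have e1 : ∀ u : ℝ, |∑' k : ℕ, weight α r (n + k) / weight α r n * Real.sin ((n + k) * u + c)| =
      (weight α r n)⁻¹ * |∑' k : ℕ, weight α r (n + k) * Real.sin ((n + k) * u + c)| := by
    intro u
    have : ∑' k : ℕ, weight α r (n + k) / weight α r n * Real.sin ((n + k) * u + c) =
        (weight α r n)⁻¹ * ∑' k : ℕ, weight α r (n + k) * Real.sin ((n + k) * u + c) := by
      rw [← tsum_mul_left]
      exact tsum_congr fun k => by ring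
    rw [this, abs_mul, abs_of_pos (inv_pos.2 hw)]
  simp only [e1] at key
  rw [intervalIntegral.integral_const_mul, one_div_div] at key
  set I := ∫ u in (-π)..π, |∑' k : ℕ, weight α r (n + k) * Real.sin ((n + k) * u + c)|
  have e2 : I - weight α r n * (4 / π * Real.log (n / (α * r * (n : ℝ) ^ r))) = weight α r n *
      ((weight α r n)⁻¹ * I - 4 / π * Real.log (n / (α * r * (n : ℝ) ^ r))) := by
    field_simp
  rw [e2, abs_mul, abs_of_pos hw, mul_comm]
  gcongr

/-! ### The error kernel: integral representation, orthogonality and L¹ norm. -/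

section

variable {α r : ℝ}

theorem abs_weight_mul_cos_le (u v : ℝ) : ‖weight α r u * Real.cos v‖ ≤ weight α r u := by
  rw [norm_mul, Real.norm_eq_abs, Real.norm_eq_abs, abs_of_pos (weight_pos _ _ _)]
  exact mul_le_of_le_one_right (weight_pos _ _ _).le (Real.abs_cos_le_one _)

theorem kernel_hasSum (hw : Summable fun k : ℕ => weight α r (k + 1)) (β t : ℝ) :
    HasSum (fun k : ℕ => weight α r (k + 1) * Real.cos (((k : ℝ) + 1) * t - β * π / 2))
      (kernel α r β t) :=
  (Summable.of_norm_bounded hw fun _ => abs_weight_mul_cos_le _ _).hasSum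

theorem continuous_kernel (hw : Summable fun k : ℕ => weight α r (k + 1)) (β : ℝ) :
    Continuous (kernel α r β) :=
  continuous_tsum (fun k => by fun_prop) hw fun k t => abs_weight_mul_cos_le (α := α) (r := r) _ _

theorem kernel_periodic (β : ℝ) : Function.Periodic (kernel α r β) (2 * π) := by
  intro t
  unfold kernel
  refine tsum_congr fun k => ?_
  have : ((k : ℝ) + 1) * (t + 2 * π) - β * π / 2 =
      ((k : ℝ) + 1) * t - β * π / 2 + ((k + 1 : ℕ) : ℝ) * (2 * π) := by push_cast; ring
  rw [this, Real.cos_add_nat_mul_two_pi]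

/-- The kernel representing the interpolation error at `x` as an integral of the generalized
derivative. -/
def errKernel (n : ℕ) (α r β x t : ℝ) : ℝ :=
  kernel α r β (x - t) - interp n (fun y => kernel α r β (y - t)) x

theorem continuous_errKernel (hw : Summable fun k : ℕ => weight α r (k + 1)) (n : ℕ) (β x : ℝ) :
    Continuous (errKernel n α r β x) := by
  have h := continuous_kernel hw β
  unfold errKernel interp
  fun_prop

theorem errKernel_periodic (n : ℕ) (β x : ℝ) :
    Function.Periodic (errKernel n α r β x) (2 * π) := by
  intro t
  have h : ∀ y : ℝ, kernel α r β (y - (t + 2 * π)) = kernel α r β (y - t) := by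
    intro y
    rw [← sub_sub, (kernel_periodic β).sub_eq]
  simp only [errKernel, h]

theorem sub_interp_eq_integral (hw : Summable fun k : ℕ => weight α r (k + 1)) {n : ℕ}
    (hn : 1 ≤ n) {β : ℝ} {f φ : ℝ → ℝ} (hφ : IntervalIntegrable φ volume (-π) π)
    (hf : IsGenDeriv α r β f φ) (x : ℝ) :
    f x - interp n f x = 1 / π * ∫ t in (-π)..π, errKernel n α r β x t * φ t := by
  obtain ⟨-, a₀, hfx⟩ := hf
  have hc := continuous_kernel hw β
  have hi : ∀ y : ℝ, IntervalIntegrable (fun t => kernel α r β (y - t) * φ t) volume (-π) π :=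
    fun y => hφ.continuousOn_mul (by fun_prop)
  -- Interpolation reproduces constants, so a₀ drops out of the error.
  have h1 : 2 / (2 * (n : ℝ) - 1) * ∑ k ∈ Finset.range (2 * n - 1), dirichlet n (x - node n k)
      = 1 := by
    have := interp_cos (n := n) (j := 0) (by omega) 0 x
    simpa [interp] using this
  have h2 : ∫ t in (-π)..π, errKernel n α r β x t * φ t =
      (∫ t in (-π)..π, kernel α r β (x - t) * φ t) - 2 / (2 * n - 1) *
        ∑ k ∈ Finset.range (2 * n - 1), (∫ t in (-π)..π, kernel α r β (node n k - t) * φ t) *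
          dirichlet n (x - node n k) := by
    have e : ∀ t, errKernel n α r β x t * φ t = kernel α r β (x - t) * φ t - 2 / (2 * n - 1) *
        ∑ k ∈ Finset.range (2 * n - 1), (kernel α r β (node n k - t) * φ t) *
          dirichlet n (x - node n k) := by
      intro t
      rw [errKernel, interp, sub_mul, mul_assoc, Finset.sum_mul]
      congr 2
      exact Finset.sum_congr rfl fun k _ => by ring
    simp only [e]
    rw [intervalIntegral.integral_sub (hi x), intervalIntegral.integral_const_mul,
      intervalIntegral.integral_finsetSum]
    · simp only [intervalIntegral.integral_mul_const]
    · exact fun k _ => (hi _).mul_const _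
    · have h := IntervalIntegrable.sum (Finset.range (2 * n - 1)) fun k _ =>
        (hi (node n k)).mul_const (dirichlet n (x - node n k))
      rw [Finset.sum_fn] at h
      exact h.const_mul _
  have h3 : interp n f x = a₀ / 2 + 1 / π * (2 / (2 * n - 1) *
        ∑ k ∈ Finset.range (2 * n - 1), (∫ t in (-π)..π, kernel α r β (node n k - t) * φ t) *
          dirichlet n (x - node n k)) := by
    have e : a₀ / 2 = a₀ / 2 * (2 / (2 * (n : ℝ) - 1) *
      ∑ k ∈ Finset.range (2 * n - 1), dirichlet n (x - node n k)) := by rw [h1, mul_one]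
    rw [e]
    simp only [interp, hfx, Finset.mul_sum, ← Finset.sum_add_distrib]
    exact Finset.sum_congr rfl fun k _ => by ring
  rw [h2, h3, hfx]
  ring

theorem hasSum_errKernel (hw : Summable fun k : ℕ => weight α r (k + 1)) {n : ℕ} (hn : 1 ≤ n)
    (β x t : ℝ) :
    HasSum (fun k : ℕ => weight α r (n + k) *
      modeErr n (n + k) (-((n + k) * t) - β * π / 2) x) (errKernel n α r β x t) := by
  have h1 : ∀ y : ℝ, HasSum (fun k : ℕ => weight α r (k + 1) *
      Real.cos (((k + 1 : ℕ) : ℝ) * y + (-((k + 1) * t) - β * π / 2))) (kernel α r β (y - t)) := by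
    intro y
    convert kernel_hasSum hw β (y - t) using 4
    push_cast; ring
  have h2 : HasSum (fun k : ℕ => weight α r (k + 1) *
      modeErr n (k + 1) (-((k + 1) * t) - β * π / 2) x) (errKernel n α r β x t) := by
    have h3 := (h1 x).sub ((hasSum_sum (s := Finset.range (2 * n - 1)) fun i _ =>
      (h1 (node n i)).mul_right (dirichlet n (x - node n i))).mul_left (2 / (2 * (n : ℝ) - 1)))
    refine h3.congr_fun fun k => ?_
    rw [modeErr, interp, mul_sub, mul_left_comm, Finset.mul_sum]
    push_cast
    congr 2
    exact Finset.sum_congr rfl fun i _ => by ring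
  -- The series starts at frequency 1, so the n - 1 terms of frequency below n are dropped; their
  -- errors vanish.
  have h4 := (hasSum_nat_add_iff' (n - 1)).2 h2
  rw [Finset.sum_eq_zero, sub_zero] at h4
  · refine h4.congr_fun fun k => ?_
    have e : k + (n - 1) + 1 = n + k := by omega
    have e' : ((k + (n - 1) : ℕ) : ℝ) + 1 = n + k := by exact_mod_cast e
    simp only [e, e']
  · intro k hk
    rw [modeErr_of_lt (by have := Finset.mem_range.1 hk; omega), mul_zero]

end

theorem integral_sin_int_mul_add {p : ℤ} (hp : p ≠ 0) (d : ℝ) :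
    ∫ t in (-π)..π, Real.sin (p * t + d) = 0 := by
  have hp' : (p : ℝ) ≠ 0 := by exact_mod_cast hp
  rw [intervalIntegral.integral_comp_mul_add (fun v => Real.sin v) hp', integral_sin]
  have : (p : ℝ) * π + d = p * -π + d + p * (2 * π) := by ring
  rw [this, Real.cos_add_int_mul_two_pi, sub_self, smul_zero]

theorem integral_trigPoly_mul_sin {n q : ℕ} (hq : n ≤ q) {T : ℝ → ℝ} (hT : T ∈ TrigPoly n) (d : ℝ) :
    ∫ t in (-π)..π, T t * Real.sin (q * t + d) = 0 := by
  have key : ∀ (k : ℕ) (e : ℝ), k < n →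
      ∫ t in (-π)..π, Real.cos (k * t + e) * Real.sin (q * t + d) = 0 := by
    intro k e hk
    have h : ∀ t : ℝ, Real.cos (k * t + e) * Real.sin (q * t + d) =
        1 / 2 * Real.sin (((q + k : ℤ) : ℝ) * t + (d + e)) +
        1 / 2 * Real.sin (((q - k : ℤ) : ℝ) * t + (d - e)) := by
      intro t
      have e1 : ((q + k : ℤ) : ℝ) * t + (d + e) = (q * t + d) + (k * t + e) := by push_cast; ring
      have e2 : ((q - k : ℤ) : ℝ) * t + (d - e) = (q * t + d) - (k * t + e) := by push_cast; ring
      rw [e1, e2, Real.sin_add (q * t + d), Real.sin_sub (q * t + d)]; ring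
    simp only [h]
    rw [intervalIntegral.integral_add (Continuous.intervalIntegrable (by fun_prop) _ _)
      (Continuous.intervalIntegrable (by fun_prop) _ _), intervalIntegral.integral_const_mul,
      intervalIntegral.integral_const_mul, integral_sin_int_mul_add (by omega),
      integral_sin_int_mul_add (by omega)]
    simp
  obtain ⟨a, b, hT⟩ := hT
  have h : ∀ t, T t * Real.sin (q * t + d) = ∑ k ∈ Finset.range n,
      (a k * (Real.cos (k * t + 0) * Real.sin (q * t + d)) +
        b k * (Real.cos (k * t + -(π / 2)) * Real.sin (q * t + d))) := by
    intro t
    rw [hT, Finset.sum_mul]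
    refine Finset.sum_congr rfl fun k _ => ?_
    rw [add_zero, ← sub_eq_add_neg, Real.cos_sub_pi_div_two]; ring
  simp only [h]
  rw [intervalIntegral.integral_finsetSum fun k _ =>
    Continuous.intervalIntegrable (by fun_prop) _ _]
  refine Finset.sum_eq_zero fun k hk => ?_
  rw [intervalIntegral.integral_add (Continuous.intervalIntegrable (by fun_prop) _ _)
      (Continuous.intervalIntegrable (by fun_prop) _ _), intervalIntegral.integral_const_mul,
      intervalIntegral.integral_const_mul, key _ _ (Finset.mem_range.1 hk),
      key _ _ (Finset.mem_range.1 hk)]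
  simp

theorem continuous_of_mem_trigPoly {n : ℕ} {T : ℝ → ℝ} (hT : T ∈ TrigPoly n) : Continuous T := by
  obtain ⟨a, b, hT⟩ := hT
  rw [funext hT]
  fun_prop

theorem periodic_of_mem_trigPoly {n : ℕ} {T : ℝ → ℝ} (hT : T ∈ TrigPoly n) :
    Function.Periodic T (2 * π) := by
  obtain ⟨a, b, hT⟩ := hT
  intro t
  rw [hT, hT]
  refine Finset.sum_congr rfl fun k _ => ?_
  rw [mul_add, Real.cos_add_nat_mul_two_pi, Real.sin_add_nat_mul_two_pi]

section

variable {α r : ℝ}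

/-- Each term of the error series is, in t, a multiple of a sine of frequency at least n, hence
orthogonal to T; the factor n + k in `hs` pays for the growth of `modeErr` when sum and integral are
exchanged. This is what lets φ be replaced by φ - T. -/
theorem integral_errKernel_mul_trigPoly (hw : Summable fun k : ℕ => weight α r (k + 1)) {n : ℕ}
    (hn : 1 ≤ n) (β x : ℝ) (hs : Summable fun k : ℕ => (n + k) * weight α r (n + k))
    {T : ℝ → ℝ} (hT : T ∈ TrigPoly n) :
    ∫ t in (-π)..π, errKernel n α r β x t * T t = 0 := by
  have hTc := continuous_of_mem_trigPoly hT
  obtain ⟨M, hM⟩ := (isCompact_Icc (a := -π) (b := π)).exists_bound_of_continuousOn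
    hTc.continuousOn
  have hmode : ∀ k : ℕ, ∃ P d : ℝ, ∀ t : ℝ,
      modeErr n (n + k) (-((n + k) * t) - β * π / 2) x = P * Real.sin (((n + k : ℕ) : ℝ) * t + d) := by
    intro k
    obtain ⟨m, j, h1, h2, -⟩ := exists_alias hn (k := n + k) (by omega)
    refine ⟨2 * Real.sin (m * ((2 * n - 1) / 2 * x)),
      -(((n + k : ℕ) : ℝ) * x - β * π / 2 - m * ((2 * n - 1) / 2 * x)), fun t => ?_⟩
    rw [modeErr_of_alias h1 h2, neg_mul, neg_mul, ← mul_neg, ← Real.sin_neg]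
    congr 2
    push_cast; ring
  choose P d hPd using hmode
  let F : ℕ → ℝ → ℝ := fun k t => weight α r (n + k) *
    modeErr n (n + k) (-((n + k) * t) - β * π / 2) x * T t
  have hFe : ∀ k t, F k t = weight α r (n + k) * P k *
      (T t * Real.sin (((n + k : ℕ) : ℝ) * t + d k)) := by
    intro k t
    simp only [F, hPd]; ring
  have hF0 : ∀ k, ∫ t in (-π)..π, F k t = 0 := by
    intro k
    simp only [hFe]
    rw [intervalIntegral.integral_const_mul, integral_trigPoly_mul_sin (by omega) hT, mul_zero]
  have hsum : HasSum (fun k => ∫ t in (-π)..π, F k t)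
      (∫ t in (-π)..π, errKernel n α r β x t * T t) := by
    refine intervalIntegral.hasSum_integral_of_dominated_convergence
      (fun k _ => 2 * |Real.sin ((2 * n - 1) / 2 * x)| * M * ((n + k) * weight α r (n + k)))
      (fun k => ?_) (fun k => ?_) (Filter.Eventually.of_forall fun t _ => hs.mul_left _) (by simp)
      (Filter.Eventually.of_forall fun t _ => (hasSum_errKernel hw hn β x t).mul_right (T t))
    · have : F k = fun t => weight α r (n + k) * P k *
        (T t * Real.sin (((n + k : ℕ) : ℝ) * t + d k)) := funext (hFe k)
      rw [this]
      exact Continuous.aestronglyMeasurable (by fun_prop)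
    · refine Filter.Eventually.of_forall fun t ht => ?_
      have hw0 := weight_pos α r (n + k)
      rw [Set.uIoc_of_le (by linarith [Real.pi_pos])] at ht
      have ht := hM t (Set.Ioc_subset_Icc_self ht)
      have h1 := abs_modeErr_le hn (n + k) (-((n + k) * t) - β * π / 2) x
      simp only [F]
      rw [norm_mul, norm_mul, Real.norm_eq_abs (weight _ _ _), abs_of_pos hw0,
        Real.norm_eq_abs (modeErr _ _ _ _)]
      calc _ ≤ weight α r (n + k) * (2 * ((n + k : ℕ) : ℝ) *
            |Real.sin ((2 * n - 1) / 2 * x)|) * M := by gcongr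
        _ = _ := by push_cast; ring
  simp only [hF0] at hsum
  exact hsum.unique hasSum_zero

theorem abs_sub_interp_le (hw : Summable fun k : ℕ => weight α r (k + 1)) {n : ℕ}
    (hn : 1 ≤ n) (hs : Summable fun k : ℕ => (n + k) * weight α r (n + k)) {β : ℝ}
    {f φ : ℝ → ℝ} (hφ : IntervalIntegrable φ volume (-π) π)
    (hf : IsGenDeriv α r β f φ) (x : ℝ) {T : ℝ → ℝ} (hT : T ∈ TrigPoly n) {M : ℝ}
    (hM : ∀ᵐ t, |φ t - T t| ≤ M) :
    |f x - interp n f x| ≤ 1 / π * (∫ t in (-π)..π, |errKernel n α r β x t|) * M := by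
  have hKc := continuous_errKernel hw n β x
  have hTc := continuous_of_mem_trigPoly hT
  have h1 : ∫ t in (-π)..π, errKernel n α r β x t * φ t =
      ∫ t in (-π)..π, errKernel n α r β x t * (φ t - T t) := by
    simp only [mul_sub]
    rw [intervalIntegral.integral_sub (hφ.continuousOn_mul hKc.continuousOn)
      (Continuous.intervalIntegrable (by fun_prop) _ _),
      integral_errKernel_mul_trigPoly hw hn β x hs hT, sub_zero]
  rw [sub_interp_eq_integral hw hn hφ hf, h1, abs_mul, abs_of_pos (by positivity), mul_assoc,
    ← intervalIntegral.integral_mul_const, ← Real.norm_eq_abs (∫ _ in _.._, _)]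
  gcongr
  refine intervalIntegral.norm_integral_le_of_norm_le (by linarith [Real.pi_pos]) ?_
    (Continuous.intervalIntegrable (by fun_prop) _ _)
  filter_upwards [hM] with t ht _
  rw [norm_mul, Real.norm_eq_abs, Real.norm_eq_abs]
  gcongr

/-- The 2n - 1 frequencies from n to 3n - 2 have alias index 1 and cancel exactly against the sine
series; only the tail remains. -/
theorem abs_errKernel_sub_le (hα : 0 < α) (hw : Summable fun k : ℕ => weight α r (k + 1)) {n : ℕ}
    (hn : 2 ≤ n) (hA : 6 ≤ α * r * (n : ℝ) ^ r) (hA2 : 6 * Real.log n ≤ α * r * (n : ℝ) ^ r)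
    (β x t : ℝ) :
    |errKernel n α r β x t + 2 * Real.sin ((2 * n - 1) / 2 * x) *
      ∑' k : ℕ, weight α r (n + k) *
        Real.sin ((n + k) * (x - t) + (-(β * π / 2) - (2 * n - 1) / 2 * x))| ≤
      4 * |Real.sin ((2 * n - 1) / 2 * x)| * weight α r n := by
  set s := Real.sin ((2 * n - 1) / 2 * x)
  obtain ⟨hs, -⟩ := summable_and_tsum_weight_le (r := r) hα (by omega : 1 ≤ n) (by linarith)
  obtain ⟨htail, htail_le⟩ := summable_and_tsum_tail_le (r := r) hα hn hA hA2
  have hG := (summable_mul_of_abs_le_one hs (fun k => (weight_pos _ _ _).le) (f := fun k : ℕ =>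
    Real.sin ((n + k) * (x - t) + (-(β * π / 2) - (2 * n - 1) / 2 * x)))
    fun k => Real.abs_sin_le_one _).hasSum.mul_left (2 * s)
  have h1 := (hasSum_errKernel hw (by omega : 1 ≤ n) β x t).add hG
  have harg : ∀ k : ℕ, ((n + k : ℕ) : ℝ) * x + (-((n + k) * t) - β * π / 2) - (2 * n - 1) / 2 * x
      = (n + k) * (x - t) + (-(β * π / 2) - (2 * n - 1) / 2 * x) := by
    intro k; push_cast; ring
  have h2 := (hasSum_nat_add_iff' (2 * n - 1)).2 h1
  rw [Finset.sum_eq_zero, sub_zero] at h2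
  · rw [← h2.tsum_eq, ← Real.norm_eq_abs]
    refine (tsum_of_norm_bounded (htail.hasSum.mul_left (2 * |s|)) fun k => ?_).trans ?_
    · have e : ((k + (2 * n - 1) : ℕ) : ℝ) = 2 * n - 1 + k := by
        rw [Nat.cast_add, Nat.cast_sub (by omega)]; push_cast; ring
      have e2 : (n : ℝ) + ((k + (2 * n - 1) : ℕ) : ℝ) = 3 * n - 1 + k := by rw [e]; ring
      have h3 := abs_modeErr_le (by omega : 1 ≤ n) (n + (k + (2 * n - 1)))
        (-((n + ((k + (2 * n - 1) : ℕ) : ℝ)) * t) - β * π / 2) x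
      have ec : ((n + (k + (2 * n - 1)) : ℕ) : ℝ) = 3 * n - 1 + k := by rw [Nat.cast_add, e2]
      rw [ec, e2] at h3
      rw [e2]
      set μ := modeErr n (n + (k + (2 * n - 1))) (-((3 * n - 1 + k) * t) - β * π / 2) x
      set σ := Real.sin ((3 * n - 1 + k) * (x - t) + (-(β * π / 2) - (2 * n - 1) / 2 * x)) with hσ
      have hσ1 : |σ| ≤ 1 := Real.abs_sin_le_one _
      have hw0 := weight_pos α r (3 * n - 1 + k)
      have e3 : weight α r (3 * n - 1 + k) * μ + 2 * s * (weight α r (3 * n - 1 + k) * σ) =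
        weight α r (3 * n - 1 + k) * (μ + 2 * s * σ) := by ring
      rw [e3, norm_mul, Real.norm_eq_abs, Real.norm_eq_abs, abs_of_pos hw0]
      -- Frequency q contributes 2q|s| from the interpolation error and 2|s| from the sine series,
      -- whence the q + 1 in the tail sum.
      have h4 : |μ + 2 * s * σ| ≤ 2 * |s| * (3 * n - 1 + k + 1) := by
        calc _ ≤ |μ| + |2 * s * σ| := abs_add_le _ _
          _ ≤ 2 * (3 * n - 1 + k) * |s| + 2 * |s| * 1 := by
            rw [abs_mul (2 * s), abs_mul 2 s, abs_two]
            gcongr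
          _ = _ := by ring
      calc _ ≤ weight α r (3 * n - 1 + k) * (2 * |s| * (3 * n - 1 + k + 1)) := by gcongr
        _ = _ := by ring
    · calc _ ≤ 2 * |s| * (2 * weight α r n) := by gcongr
        _ = _ := by ring
  · intro k hk
    rw [modeErr_main (by omega) (by have := Finset.mem_range.1 hk; omega), harg]
    ring

theorem abs_integral_abs_errKernel_sub_le (hα : 0 < α) (hr0 : 0 < r) (hr1 : r < 1)
    (hw : Summable fun k : ℕ => weight α r (k + 1)) {n : ℕ}
    (hn : 2 ≤ n) (hA : 6 ≤ α * r * (n : ℝ) ^ r) (hA2 : 6 * Real.log n ≤ α * r * (n : ℝ) ^ r)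
    (hAn : α * r * (n : ℝ) ^ r ≤ n) (β x : ℝ) :
    |(∫ t in (-π)..π, |errKernel n α r β x t|) - 2 * |Real.sin ((2 * n - 1) / 2 * x)| *
      (weight α r n * (4 / π * Real.log (n / (α * r * (n : ℝ) ^ r))))| ≤
      2 * |Real.sin ((2 * n - 1) / 2 * x)| * (60 * weight α r n) := by
  obtain ⟨hs, -⟩ := summable_and_tsum_weight_le (r := r) hα (by omega : 1 ≤ n) (by linarith)
  set s := Real.sin ((2 * n - 1) / 2 * x) with hsdef
  set c := -(β * π / 2) - (2 * n - 1) / 2 * x with hcdef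
  have hGc := continuous_tsum_mul_sin hs (fun k => (weight_pos α r (n + k)).le) n c
  set G : ℝ → ℝ := fun u : ℝ => ∑' k : ℕ, weight α r (n + k) * Real.sin ((n + k) * u + c) with hG
  have h1 := abs_integral_abs_weight_series_sub_le hα hr0 hr1 hn (by linarith) hAn c
  have hper : Function.Periodic (fun u => |G u|) (2 * π) := by
    intro u
    simp only [hG]
    congr 1
    refine tsum_congr fun k => ?_
    have : ((n : ℝ) + k) * (u + 2 * π) + c = (n + k) * u + c + ((n + k : ℕ) : ℝ) * (2 * π) := by
      push_cast; ring
    rw [this, Real.sin_add_nat_mul_two_pi]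
  have h2 : ∫ t in (-π)..π, |G (x - t)| = ∫ u in (-π)..π, |G u| := by
    rw [intervalIntegral.integral_comp_sub_left (fun u => |G u|) x]
    have := hper.intervalIntegral_add_eq (x - π) (-π)
    have e1 : x - π + 2 * π = x - -π := by ring
    have e2 : -π + 2 * π = π := by ring
    rwa [e1, e2] at this
  have hKc := continuous_errKernel hw n β x
  have h3 : |(∫ t in (-π)..π, |errKernel n α r β x t|) -
      2 * |s| * (∫ t in (-π)..π, |G (x - t)|)| ≤
      4 * |s| * weight α r n * (2 * π) := by
    rw [← intervalIntegral.integral_const_mul, ← intervalIntegral.integral_sub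
      (Continuous.intervalIntegrable (by fun_prop) _ _)
      (Continuous.intervalIntegrable (by fun_prop) _ _)]
    have := intervalIntegral.norm_integral_le_of_norm_le_const (a := -π) (b := π)
      (C := 4 * |s| * weight α r n)
      (f := fun t => |errKernel n α r β x t| - 2 * |s| * |G (x - t)|) (fun t _ => by
        have h := abs_errKernel_sub_le hα hw hn hA hA2 β x t
        have e : 2 * |s| * |G (x - t)| = |-(2 * s * G (x - t))| := by
          rw [abs_neg, abs_mul, abs_mul, abs_two]
        rw [Real.norm_eq_abs, e]
        refine (abs_abs_sub_abs_le _ _).trans ?_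
        rw [sub_neg_eq_add]
        exact h)
    rw [Real.norm_eq_abs, sub_neg_eq_add, ← two_mul, abs_of_pos Real.two_pi_pos] at this
    exact this
  rw [h2] at h3
  have hw0 := weight_pos α r n
  set I := ∫ u in (-π)..π, |G u|
  have h4 : |2 * |s| * I - 2 * |s| *
      (weight α r n * (4 / π * Real.log (n / (α * r * (n : ℝ) ^ r))))| ≤
      2 * |s| * (42 * weight α r n) := by
    rw [← mul_sub, abs_mul, abs_of_nonneg (by positivity : 0 ≤ 2 * |s|)]
    gcongr
  -- 4π < 18, and 60 = 42 + 18.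
  have h5 : 4 * |s| * weight α r n * (2 * π) ≤ 2 * |s| * (18 * weight α r n) := by
    have : 0 ≤ |s| * weight α r n := by positivity
    nlinarith [Real.pi_lt_d2]
  refine (abs_sub_le _ (2 * |s| * I) _).trans ?_
  linarith

end

/-! ### Best approximation, alternation and the near-extremal function. -/

theorem exists_abs_le_of_periodic {ψ : ℝ → ℝ} (hp : Function.Periodic ψ (2 * π))
    (hc : Continuous ψ) : ∃ M : ℝ, 0 ≤ M ∧ ∀ t, |ψ t| ≤ M := by
  obtain ⟨M, hM⟩ := (isCompact_Icc (a := 0) (b := 2 * π)).exists_bound_of_continuousOn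
    hc.continuousOn
  have h : ∀ t, |ψ t| ≤ M := by
    intro t
    obtain ⟨y, hy, hyt⟩ := hp.exists_mem_Ico₀ Real.two_pi_pos t
    rw [hyt]
    exact hM y (Set.Ico_subset_Icc_self hy)
  exact ⟨M, (abs_nonneg _).trans (h 0), h⟩

theorem abs_le_normC {ψ : ℝ → ℝ} (hp : Function.Periodic ψ (2 * π)) (hc : Continuous ψ) (t : ℝ) :
    |ψ t| ≤ normC ψ := by
  obtain ⟨M, -, hM⟩ := exists_abs_le_of_periodic hp hc
  exact le_ciSup (f := fun t => |ψ t|) ⟨M, by rintro _ ⟨y, rfl⟩; exact hM y⟩ t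

theorem const_mem_trigPoly {n : ℕ} (hn : 1 ≤ n) (c : ℝ) : (fun _ => c) ∈ TrigPoly n := by
  refine ⟨fun k => if k = 0 then c else 0, fun _ => 0, fun x => ?_⟩
  rw [Finset.sum_eq_single_of_mem 0 (Finset.mem_range.2 (by omega))]
  · simp
  · intro k _ hk; simp [hk]

/-- Passes from all polynomials to the infimum, so that no best approximant is needed. -/
theorem le_mul_sInf {S : Set ℝ} (hS : S.Nonempty) {a J : ℝ} (hJ : 0 ≤ J)
    (h : ∀ m ∈ S, a ≤ J * m) : a ≤ J * sInf S := by
  rcases hJ.eq_or_lt with rfl | hJ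
  · obtain ⟨m, hm⟩ := hS
    simpa using h m hm
  · rw [← div_le_iff₀' hJ]
    exact le_csInf hS fun m hm => by rw [div_le_iff₀' hJ]; exact h m hm

theorem bestC_nonneg (n : ℕ) (φ : ℝ → ℝ) : 0 ≤ bestC n φ := by
  refine Real.sInf_nonneg ?_
  rintro _ ⟨T, -, rfl⟩
  exact Real.iSup_nonneg fun t => abs_nonneg _

theorem bestLInfty_nonneg (n : ℕ) (φ : ℝ → ℝ) : 0 ≤ bestLInfty n φ := by
  refine Real.sInf_nonneg ?_
  rintro _ ⟨T, -, rfl⟩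
  exact ENNReal.toReal_nonneg

theorem cos_nat_mul_alternation {n : ℕ} (hn : 1 ≤ n) (i : ℕ) :
    Real.cos (n * (2 * i * π / (2 * n : ℕ))) ^ 2 = 1 := by
  have hn' : (n : ℝ) ≠ 0 := by positivity
  have e : (n : ℝ) * (2 * i * π / (2 * n : ℕ)) = i * π := by push_cast; field_simp
  have := Real.sin_sq_add_cos_sq (i * π)
  rw [Real.sin_nat_mul_pi] at this
  rw [e]; linarith

/-- Trigonometric polynomials of order at most `n - 1` are annihilated by the alternating sum over
`2 n` equispaced points. -/
theorem sum_cos_mul_trigPoly {n : ℕ} {T : ℝ → ℝ} (hT : T ∈ TrigPoly n) :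
    ∑ i ∈ Finset.range (2 * n), Real.cos (n * (2 * i * π / (2 * n : ℕ))) *
      T (2 * i * π / (2 * n : ℕ)) = 0 := by
  have key : ∀ (k : ℕ) (e : ℝ), k < n → ∑ i ∈ Finset.range (2 * n),
      Real.cos (n * (2 * i * π / (2 * n : ℕ))) * Real.cos (k * (2 * i * π / (2 * n : ℕ)) + e)
      = 0 := by
    intro k e hk
    have h : ∀ t : ℝ, Real.cos (n * t) * Real.cos (k * t + e) =
        1 / 2 * Real.cos (((n + k : ℤ) : ℝ) * t + e) +
        1 / 2 * Real.cos (((n - k : ℤ) : ℝ) * t + -e) := by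
      intro t
      have e1 : ((n + k : ℤ) : ℝ) * t + e = n * t + (k * t + e) := by push_cast; ring
      have e2 : ((n - k : ℤ) : ℝ) * t + -e = n * t - (k * t + e) := by push_cast; ring
      rw [e1, e2, Real.cos_add (n * t), Real.cos_sub (n * t)]; ring
    simp only [h, Finset.sum_add_distrib, ← Finset.mul_sum]
    rw [sum_cos_equispaced _ _ (sin_int_mul_pi_div_ne_zero (by omega)
      (by rw [abs_lt]; push_cast; omega)), sum_cos_equispaced _ _ (sin_int_mul_pi_div_ne_zero
      (by omega) (by rw [abs_lt]; push_cast; omega))]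
    simp
  obtain ⟨a, b, hT⟩ := hT
  have h : ∀ t, Real.cos (n * t) * T t = ∑ k ∈ Finset.range n,
      (a k * (Real.cos (n * t) * Real.cos (k * t + 0)) +
        b k * (Real.cos (n * t) * Real.cos (k * t + -(π / 2)))) := by
    intro t
    rw [hT, Finset.mul_sum]
    refine Finset.sum_congr rfl fun k _ => ?_
    rw [add_zero, ← sub_eq_add_neg, Real.cos_sub_pi_div_two]; ring
  simp only [h]
  rw [Finset.sum_comm]
  refine Finset.sum_eq_zero fun k hk => ?_
  rw [Finset.sum_add_distrib, ← Finset.mul_sum, ← Finset.mul_sum, key _ _ (Finset.mem_range.1 hk),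
    key _ _ (Finset.mem_range.1 hk)]
  simp

/-- A function that, up to a constant, alternates between `±E` at `2 n` equispaced points and is
bounded by `E` has best approximation `E`. -/
theorem bestC_eq_of_alternation {n : ℕ} (hn : 1 ≤ n) {Φ : ℝ → ℝ} (hp : Function.Periodic Φ (2 * π))
    (hc : Continuous Φ) {E κ : ℝ} (hE : ∀ t, |Φ t + κ| ≤ E)
    (halt : ∀ i : ℕ, Φ (2 * i * π / (2 * n : ℕ)) + κ =
      E * Real.cos (n * (2 * i * π / (2 * n : ℕ)))) :
    bestC n Φ = E := by
  have hlow : ∀ T ∈ TrigPoly n, E ≤ normC (Φ - T) := by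
    intro T hT
    have hle : ∀ t, |Φ t - T t| ≤ normC (Φ - T) := abs_le_normC
      (hp.sub (periodic_of_mem_trigPoly hT)) (hc.sub (continuous_of_mem_trigPoly hT))
    -- Duality: the signs cos(n t) = ±1 annihilate T + κ, so pairing them with Φ - T gives exactly
    -- 2nE, while each of the 2n terms is at most the norm.
    have h0 := sum_cos_mul_trigPoly (trigPoly_add hT (const_mem_trigPoly hn κ))
    have h1 : ∑ i ∈ Finset.range (2 * n), Real.cos (n * (2 * i * π / (2 * n : ℕ))) *
        (Φ (2 * i * π / (2 * n : ℕ)) - T (2 * i * π / (2 * n : ℕ))) = 2 * n * E := by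
      have : ∀ i ∈ Finset.range (2 * n), Real.cos (n * (2 * i * π / (2 * n : ℕ))) *
          (Φ (2 * i * π / (2 * n : ℕ)) - T (2 * i * π / (2 * n : ℕ))) =
          E - Real.cos (n * (2 * i * π / (2 * n : ℕ))) * (T (2 * i * π / (2 * n : ℕ)) + κ) := by
        intro i _
        have h2 := cos_nat_mul_alternation hn i
        have h3 := halt i
        set t := 2 * (i : ℝ) * π / (2 * n : ℕ)
        have h4 : Φ t - T t = E * Real.cos (n * t) - (T t + κ) := by linarith
        rw [h4, mul_sub, mul_left_comm, ← sq, h2, mul_one]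
      rw [Finset.sum_congr rfl this, Finset.sum_sub_distrib, h0]
      simp
    have h2 : ∑ i ∈ Finset.range (2 * n), Real.cos (n * (2 * i * π / (2 * n : ℕ))) *
        (Φ (2 * i * π / (2 * n : ℕ)) - T (2 * i * π / (2 * n : ℕ))) ≤
        ∑ i ∈ Finset.range (2 * n), normC (Φ - T) := by
      refine Finset.sum_le_sum fun i _ => (le_abs_self _).trans ?_
      rw [abs_mul]
      calc _ ≤ 1 * normC (Φ - T) := by
            gcongr
            · exact Real.abs_cos_le_one _
            · exact hle _
        _ = _ := one_mul _
    rw [h1, Finset.sum_const, Finset.card_range, nsmul_eq_mul] at h2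
    push_cast at h2
    have hn' : (0 : ℝ) < 2 * n := by positivity
    exact le_of_mul_le_mul_left h2 hn'
  unfold bestC
  refine le_antisymm ?_ ?_
  · have hbdd : BddBelow ((fun T : ℝ → ℝ => normC (Φ - T)) '' TrigPoly n) := by
      refine ⟨0, ?_⟩
      rintro _ ⟨T, -, rfl⟩
      exact Real.iSup_nonneg fun t => abs_nonneg _
    refine (csInf_le hbdd ⟨_, const_mem_trigPoly hn (-κ), rfl⟩).trans (ciSup_le fun t => ?_)
    simpa using hE t
  · refine le_csInf (Set.Nonempty.image _ ⟨_, const_mem_trigPoly hn 0⟩) ?_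
    rintro _ ⟨T, hT, rfl⟩
    exact hlow T hT

/-- Provides cutoffs equal to 1 at the alternation points with arbitrarily small integral: cos² < 1
off a countable set. -/
theorem tendsto_integral_cos_sq_pow {n : ℕ} (hn : 1 ≤ n) :
    Filter.Tendsto (fun m : ℕ => ∫ t in (-π)..π, (Real.cos (n * t) ^ 2) ^ m) Filter.atTop
      (nhds 0) := by
  have hn' : (n : ℝ) ≠ 0 := by positivity
  have h0 : ∫ t in (-π)..π, (0 : ℝ) = 0 := by simp
  rw [← h0]
  refine intervalIntegral.tendsto_integral_filter_of_dominated_convergence (fun _ => 1)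
    (Filter.Eventually.of_forall fun m => Continuous.aestronglyMeasurable (by fun_prop))
    (Filter.Eventually.of_forall fun m => Filter.Eventually.of_forall fun t _ => ?_)
    (by simp) ?_
  · rw [Real.norm_eq_abs, abs_of_nonneg (by positivity)]
    exact pow_le_one₀ (by positivity) (Real.cos_sq_le_one _)
  · have hcount : (Set.range fun k : ℤ => (k : ℝ) * π / n).Countable := Set.countable_range _
    filter_upwards [hcount.ae_notMem volume] with t ht _
    refine tendsto_pow_atTop_nhds_zero_of_lt_one (by positivity) ?_
    have hs : Real.sin (n * t) ≠ 0 := by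
      intro h
      obtain ⟨k, hk⟩ := Real.sin_eq_zero_iff.1 h
      exact ht ⟨k, by simp only [hk]; field_simp⟩
    have := Real.sin_sq_add_cos_sq (n * t)
    have : 0 < Real.sin (n * t) ^ 2 := by positivity
    linarith

/-- A continuous function with alternation at equispaced points, almost equal to the sign of `K`. -/
theorem exists_alternating_near_sign {K : ℝ → ℝ} (hp : Function.Periodic K (2 * π))
    (hc : Continuous K) {n : ℕ} (hn : 1 ≤ n) {η : ℝ} (hη : 0 < η) :
    ∃ s : ℝ → ℝ, Function.Periodic s (2 * π) ∧ Continuous s ∧ (∀ t, |s t| ≤ 1) ∧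
      (∀ i : ℕ, s (2 * i * π / (2 * n : ℕ)) = Real.cos (n * (2 * i * π / (2 * n : ℕ)))) ∧
      (∫ t in (-π)..π, |K t|) - η ≤ ∫ t in (-π)..π, K t * s t := by
  obtain ⟨B, hB0, hB⟩ := exists_abs_le_of_periodic hp hc
  have hlim := (tendsto_integral_cos_sq_pow hn).const_mul (2 * B)
  rw [mul_zero] at hlim
  obtain ⟨m, hm⟩ := (hlim.eventually (gt_mem_nhds (half_pos hη))).exists
  -- Half of η pays for the regularization of the sign, 2πε = η/2, and half for the cutoff, through
  -- `hm`.
  set ε := η / (4 * π) with hε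
  have hε0 : 0 < ε := by positivity
  set χ : ℝ → ℝ := fun t => (Real.cos (n * t) ^ 2) ^ m with hχ
  have hχc : Continuous χ := by fun_prop
  have hχ0 : ∀ t, 0 ≤ χ t := fun t => by positivity
  have hχ1 : ∀ t, χ t ≤ 1 := fun t => pow_le_one₀ (by positivity) (Real.cos_sq_le_one _)
  have hcosp : ∀ t : ℝ, Real.cos (n * (t + 2 * π)) = Real.cos (n * t) := by
    intro t; rw [mul_add, Real.cos_add_nat_mul_two_pi]
  -- A convex combination, with weight χ, of the regularized sign K / (|K| + ε) and cos(n t).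
  have hden : ∀ t, 0 < |K t| + ε := fun t => by positivity
  refine ⟨fun t => (1 - χ t) * (K t / (|K t| + ε)) + χ t * Real.cos (n * t), ?_, ?_, ?_, ?_, ?_⟩
  · intro t
    simp only [hχ, hcosp, hp t]
  · have : Continuous fun t => K t / (|K t| + ε) :=
      hc.div (by fun_prop) fun t => (hden t).ne'
    fun_prop
  · intro t
    have h1 : |K t / (|K t| + ε)| ≤ 1 := by
      rw [abs_div, abs_of_pos (hden t), div_le_one (hden t)]
      linarith
    calc _ ≤ |(1 - χ t) * (K t / (|K t| + ε))| + |χ t * Real.cos (n * t)| := abs_add_le _ _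
      _ ≤ (1 - χ t) * 1 + χ t * 1 := by
        have h2 : 0 ≤ 1 - χ t := sub_nonneg.2 (hχ1 t)
        have h3 := hχ0 t
        rw [abs_mul, abs_mul, abs_of_nonneg h2, abs_of_nonneg h3]
        gcongr
        exact Real.abs_cos_le_one _
      _ = 1 := by ring
  · intro i
    have : χ (2 * i * π / (2 * n : ℕ)) = 1 := by
      simp only [hχ]
      rw [cos_nat_mul_alternation hn, one_pow]
    simp only [this]
    ring
  · have hquot : Continuous fun t => K t / (|K t| + ε) :=
      hc.div (by fun_prop) fun t => (hden t).ne'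
    have hpt : ∀ t, |K t| - ε - 2 * B * χ t ≤
        K t * ((1 - χ t) * (K t / (|K t| + ε)) + χ t * Real.cos (n * t)) := by
      intro t
      have h1 : |K t| - ε ≤ K t * (K t / (|K t| + ε)) := by
        rw [← mul_div_assoc, le_div_iff₀ (hden t)]
        nlinarith [abs_mul_abs_self (K t)]
      have h2 : -B ≤ K t * Real.cos (n * t) := by
        have : |K t * Real.cos (n * t)| ≤ B * 1 := by
          rw [abs_mul]
          exact mul_le_mul (hB t) (Real.abs_cos_le_one _) (abs_nonneg _) hB0
        linarith [neg_abs_le (K t * Real.cos (n * t))]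
      have h3 := mul_le_mul_of_nonneg_left h1 (sub_nonneg.2 (hχ1 t))
      have h4 := mul_le_mul_of_nonneg_left h2 (hχ0 t)
      have h5 := mul_le_mul_of_nonneg_left (hB t) (hχ0 t)
      have h6 := mul_nonneg (hχ0 t) hε0.le
      nlinarith
    have hmono := intervalIntegral.integral_mono_on (μ := volume) (a := -π) (b := π)
      (f := fun t => |K t| - ε - 2 * B * χ t)
      (g := fun t => K t * ((1 - χ t) * (K t / (|K t| + ε)) + χ t * Real.cos (n * t)))
      (by linarith [Real.pi_pos]) (Continuous.intervalIntegrable (by fun_prop) _ _)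
      (Continuous.intervalIntegrable (by fun_prop) _ _) fun t _ => hpt t
    refine le_trans ?_ hmono
    rw [intervalIntegral.integral_sub (Continuous.intervalIntegrable (by fun_prop) _ _)
      (Continuous.intervalIntegrable (by fun_prop) _ _),
      intervalIntegral.integral_sub (Continuous.intervalIntegrable (by fun_prop) _ _)
      (by simp), intervalIntegral.integral_const_mul, intervalIntegral.integral_const, smul_eq_mul]
    have : (π - -π) * ε = η / 2 := by rw [hε]; field_simp; norm_num
    linarith

theorem ae_abs_sub_le_normLInfty {n : ℕ} {φ T : ℝ → ℝ} (hφ : φ ∈ SpaceLInfty) (hT : T ∈ TrigPoly n) :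
    ∀ᵐ t, |φ t - T t| ≤ normLInfty (φ - T) := by
  have hTc := continuous_of_mem_trigPoly hT
  obtain ⟨M, -, hM⟩ := exists_abs_le_of_periodic (periodic_of_mem_trigPoly hT) hTc
  have hTm : MemLp T ⊤ volume := memLp_top_of_bound hTc.aestronglyMeasurable M
    (Filter.Eventually.of_forall hM)
  have hm := hφ.2.sub hTm
  have h := ae_le_eLpNormEssSup (f := φ - T) (μ := volume)
  filter_upwards [h] with t ht
  rw [← eLpNorm_exponent_top] at ht
  have h2 := ENNReal.toReal_mono hm.eLpNorm_ne_top ht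
  rwa [toReal_enorm, Real.norm_eq_abs] at h2

theorem intervalIntegrable_of_mem_spaceLInfty {φ : ℝ → ℝ} (hφ : φ ∈ SpaceLInfty) (a b : ℝ) :
    IntervalIntegrable φ volume a b := by
  rw [intervalIntegrable_iff]
  have : IsFiniteMeasure (volume.restrict (Set.uIoc a b)) := ⟨by simp [Set.uIoc]⟩
  exact (hφ.2.restrict _).integrable le_top

/-! ### Consequences of the condition on n, and the final assembly. -/

theorem frequency_bounds {α r : ℝ} (hα : 0 < α) (hr0 : 0 < r) {n : ℕ} (hn : 1 ≤ n)
    (hstar : Real.log (Real.pi * n) / (α * r * (n : ℝ) ^ r) + α * r / (n : ℝ) ^ (1 - r)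
      ≤ 1 / (3 * Real.pi) ^ 3) :
    2 ≤ n ∧ 6 ≤ α * r * (n : ℝ) ^ r ∧ 6 * Real.log n ≤ α * r * (n : ℝ) ^ r ∧
      α * r * (n : ℝ) ^ r ≤ n ∧ (n : ℝ) ^ (1 - r) / (α * r) = n / (α * r * (n : ℝ) ^ r) := by
  have hn1 : (1 : ℝ) ≤ n := by exact_mod_cast hn
  have hn0 : (0 : ℝ) < n := by linarith
  have hnr : 0 < (n : ℝ) ^ r := Real.rpow_pos_of_pos hn0 r
  have hpow : (n : ℝ) ^ (1 - r) = n / (n : ℝ) ^ r := by rw [Real.rpow_sub hn0, Real.rpow_one]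
  set A := α * r * (n : ℝ) ^ r with hA
  have hA0 : 0 < A := by positivity
  have hlog1 : 1 ≤ Real.log (π * n) := by
    rw [Real.le_log_iff_exp_le (by positivity)]
    nlinarith [Real.exp_one_lt_d9, Real.pi_gt_three]
  have hlogn : Real.log n ≤ Real.log (π * n) :=
    Real.log_le_log hn0 (by nlinarith [Real.pi_gt_three])
  have e : α * r / (n : ℝ) ^ (1 - r) = A / n := by rw [hpow, hA]; field_simp
  -- Only the bound 1/6 is needed: both summands are positive, and log(πn) ≥ 1 because e < π.
  have hc : 1 / (3 * Real.pi) ^ 3 ≤ 1 / 6 := by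
    have h9 : (9 : ℝ) ≤ 3 * π := by linarith [Real.pi_gt_three]
    have : (9 : ℝ) ^ 3 ≤ (3 * π) ^ 3 := by gcongr
    gcongr
    linarith
  rw [e] at hstar
  have h1 : 0 < Real.log (π * n) / A := by positivity
  have h2 : 0 < A / n := by positivity
  have h3 : Real.log (π * n) / A ≤ 1 / 6 := by linarith
  have h4 : A / n ≤ 1 / 6 := by linarith
  rw [div_le_iff₀ hA0] at h3
  rw [div_le_iff₀ hn0] at h4
  refine ⟨?_, by linarith, by linarith, by linarith, ?_⟩
  · have : (2 : ℝ) ≤ n := by linarith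
    exact_mod_cast this
  · rw [hpow, hA]; field_simp

theorem summable_weights {α r : ℝ} (hα : 0 < α) {n : ℕ} (hn : 2 ≤ n)
    (hA : 6 ≤ α * r * (n : ℝ) ^ r) (hA2 : 6 * Real.log n ≤ α * r * (n : ℝ) ^ r) :
    (Summable fun k : ℕ => weight α r (k + 1)) ∧
      Summable fun k : ℕ => (n + k) * weight α r (n + k) := by
  obtain ⟨h1, -⟩ := summable_and_tsum_weight_le (r := r) hα (by omega : 1 ≤ n) (by linarith)
  obtain ⟨h2, -⟩ := summable_and_tsum_tail_le (r := r) hα hn hA hA2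
  constructor
  · have h3 : Summable fun k : ℕ => weight α r k := by
      rw [← summable_nat_add_iff n]
      refine h1.congr fun k => ?_
      push_cast; rw [add_comm]
    have h4 := (summable_nat_add_iff 1).2 h3
    simpa using h4
  · rw [← summable_nat_add_iff (2 * n - 1)]
    refine Summable.of_nonneg_of_le (fun k => ?_) (fun k => ?_) h2
    · have := weight_pos α r (n + ((k + (2 * n - 1) : ℕ) : ℝ))
      positivity
    · have e : (n : ℝ) + ((k + (2 * n - 1) : ℕ) : ℝ) = 3 * n - 1 + k := by
        rw [Nat.cast_add, Nat.cast_sub (by omega)]; push_cast; ring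
      rw [e]
      exact mul_le_mul_of_nonneg_right (by linarith) (weight_pos α r (3 * n - 1 + k)).le

theorem isGenDeriv_integral {α r β : ℝ} {Φ : ℝ → ℝ} (h : ∫ t in (-π)..π, Φ t = 0) :
    IsGenDeriv α r β (fun x => 1 / π * ∫ t in (-π)..π, kernel α r β (x - t) * Φ t) Φ :=
  ⟨h, 0, fun x => by simp⟩

end GenPoisson

end

theorem theorem3 (α r β : ℝ) (hα : 0 < α) (hr0 : 0 < r) (hr1 : r < 1) (n : ℕ) (hn : 1 ≤ n)
    (hstar : Real.log (Real.pi * n) / (α * r * (n : ℝ) ^ r) + α * r / (n : ℝ) ^ (1 - r)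
      ≤ 1 / (3 * Real.pi) ^ 3) (x : ℝ) :
    (∃ γ : ℝ, |γ| < 20 * Real.pi ^ 4 ∧
      ∀ f φ : ℝ → ℝ, φ ∈ GenPoisson.SpaceLInfty → GenPoisson.IsGenDeriv α r β f φ →
        |f x - GenPoisson.interp n f x| ≤
          2 * Real.exp (-α * (n : ℝ) ^ r) * |Real.sin ((2 * n - 1) / 2 * x)| *
            (4 / Real.pi ^ 2 * Real.log ((n : ℝ) ^ (1 - r) / (α * r)) + γ) *
              GenPoisson.bestLInfty n φ) ∧
    (∀ f φ : ℝ → ℝ, φ ∈ GenPoisson.SpaceC → GenPoisson.IsGenDeriv α r β f φ →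
      ∃ F Φ : ℝ → ℝ, Φ ∈ GenPoisson.SpaceC ∧ GenPoisson.IsGenDeriv α r β F Φ ∧
        GenPoisson.bestC n Φ = GenPoisson.bestC n φ ∧
        ∃ γ : ℝ, |γ| < 1951 ∧
          |F x - GenPoisson.interp n F x| =
            2 * Real.exp (-α * (n : ℝ) ^ r) * |Real.sin ((2 * n - 1) / 2 * x)| *
              (4 / Real.pi ^ 2 * Real.log ((n : ℝ) ^ (1 - r) / (α * r)) + γ) *
                GenPoisson.bestC n φ) := by
  obtain ⟨hn2, hA, hA2, hAn, hlog⟩ := GenPoisson.frequency_bounds hα hr0 hn hstar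
  obtain ⟨hw, hs⟩ := GenPoisson.summable_weights hα hn2 hA hA2
  have hL1 := GenPoisson.abs_integral_abs_errKernel_sub_le hα hr0 hr1 hw hn2 hA hA2 hAn β x
  have hKc := GenPoisson.continuous_errKernel hw n β x
  have hKp := GenPoisson.errKernel_periodic (α := α) (r := r) n β x
  have herr := fun (f φ : ℝ → ℝ) (hφ : IntervalIntegrable φ volume (-π) π)
    (hf : GenPoisson.IsGenDeriv α r β f φ) (T : ℝ → ℝ) (hT : T ∈ GenPoisson.TrigPoly n) (M : ℝ)
    (hM : ∀ᵐ t, |φ t - T t| ≤ M) =>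
    GenPoisson.abs_sub_interp_le hw hn hs hφ hf x hT hM
  rw [hlog]
  change |_ - 2 * |Real.sin ((2 * n - 1) / 2 * x)| * (Real.exp (-α * (n : ℝ) ^ r) * _)| ≤
    2 * |Real.sin ((2 * n - 1) / 2 * x)| * (60 * Real.exp (-α * (n : ℝ) ^ r)) at hL1
  set I := ∫ t in (-π)..π, |GenPoisson.errKernel n α r β x t| with hI
  set W := 2 * Real.exp (-α * (n : ℝ) ^ r) * |Real.sin ((2 * n - 1) / 2 * x)| with hW
  set Λ := 4 / π ^ 2 * Real.log (n / (α * r * (n : ℝ) ^ r)) with hΛ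
  have hW0 : 0 ≤ W := by positivity
  have hπ := Real.pi_pos
  -- The constant is 60/π ≤ 60/3 = 20.
  have hJ : |1 / π * I - W * Λ| ≤ W * 20 := by
    have e : 1 / π * I - W * Λ = 1 / π * (I - 2 * |Real.sin ((2 * n - 1) / 2 * x)| *
        (Real.exp (-α * (n : ℝ) ^ r) * (4 / π * Real.log (n / (α * r * (n : ℝ) ^ r))))) := by
      rw [hW, hΛ]; field_simp
    have h3 : 1 / π ≤ 1 / 3 := by gcongr; exact Real.pi_gt_three.le
    rw [e, abs_mul, abs_of_pos (by positivity : 0 < 1 / π)]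
    calc _ ≤ 1 / 3 * (2 * |Real.sin ((2 * n - 1) / 2 * x)| *
          (60 * Real.exp (-α * (n : ℝ) ^ r))) := by gcongr
      _ = W * 20 := by rw [hW]; ring
  have hI0 : 0 ≤ I := intervalIntegral.integral_nonneg (by linarith) fun t _ => abs_nonneg _
  have hJ0 : 0 ≤ 1 / π * I := by positivity
  have hJ2 := abs_le.1 hJ
  constructor
  · refine ⟨20, ?_, fun f φ hφ hf => ?_⟩
    · rw [abs_of_pos (by norm_num)]
      have : (1 : ℝ) < π ^ 4 := one_lt_pow₀ (by linarith [Real.pi_gt_three]) (by norm_num)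
      linarith
    · have h := GenPoisson.le_mul_sInf (a := |f x - GenPoisson.interp n f x|)
        ⟨_, _, GenPoisson.const_mem_trigPoly hn 0, rfl⟩ hJ0
        (S := (fun T : ℝ → ℝ => GenPoisson.normLInfty (φ - T)) '' GenPoisson.TrigPoly n) (by
          rintro _ ⟨T, hT, rfl⟩
          exact herr f φ (GenPoisson.intervalIntegrable_of_mem_spaceLInfty hφ _ _) hf T hT _
            (GenPoisson.ae_abs_sub_le_normLInfty hφ hT))
      refine h.trans (mul_le_mul_of_nonneg_right ?_ (GenPoisson.bestLInfty_nonneg n φ))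
      linarith
  · intro f φ hφ hf
    have hE0 := GenPoisson.bestC_nonneg n φ
    have hup : |f x - GenPoisson.interp n f x| ≤ 1 / π * I * GenPoisson.bestC n φ :=
      GenPoisson.le_mul_sInf ⟨_, _, GenPoisson.const_mem_trigPoly hn 0, rfl⟩ hJ0
        (S := (fun T : ℝ → ℝ => GenPoisson.normC (φ - T)) '' GenPoisson.TrigPoly n) (by
          rintro _ ⟨T, hT, rfl⟩
          exact herr f φ (hφ.2.intervalIntegrable _ _) hf T hT _
            (Filter.Eventually.of_forall (GenPoisson.abs_le_normC
              (hφ.1.sub (GenPoisson.periodic_of_mem_trigPoly hT))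
              (hφ.2.sub (GenPoisson.continuous_of_mem_trigPoly hT)))))
    set E := GenPoisson.bestC n φ with hE
    -- If W E = 0, the upper bound makes the error of f itself vanish, so f serves as F with γ = 0.
    by_cases hdeg : W * E = 0
    · refine ⟨f, φ, hφ, hf, rfl, 0, by norm_num, ?_⟩
      have h0 : |f x - GenPoisson.interp n f x| = 0 := by
        refine le_antisymm (hup.trans ?_) (abs_nonneg _)
        have : 1 / π * I ≤ W * (Λ + 20) := by linarith
        calc _ ≤ W * (Λ + 20) * E := by gcongr
          _ = (W * E) * (Λ + 20) := by ring
          _ = 0 := by rw [hdeg, zero_mul]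
      rw [h0, mul_right_comm, hdeg, zero_mul]
    · have hWE : 0 < W * E := lt_of_le_of_ne (by positivity) (Ne.symm hdeg)
      have hWpos : 0 < W := pos_of_mul_pos_left hWE hE0
      -- The tolerance is η = W: it changes the final γ by at most 1/π, so |γ| stays below 21.
      obtain ⟨s, hsp, hsc, hs1, hsalt, hsint⟩ :=
        GenPoisson.exists_alternating_near_sign hKp hKc hn hWpos
      -- κ is the mean of E s, subtracted so that Φ integrates to zero. Being constant, it affects
      -- neither the best approximation nor the integral against K.
      set κ := E * (1 / (2 * π) * ∫ t in (-π)..π, s t) with hκ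
      set Φ : ℝ → ℝ := fun t => E * s t - κ with hΦ
      have hΦc : Continuous Φ := by fun_prop
      have hΦp : Function.Periodic Φ (2 * π) := fun t => by simp only [hΦ, hsp t]
      have hΦ0 : ∫ t in (-π)..π, Φ t = 0 := by
        simp only [hΦ]
        rw [intervalIntegral.integral_sub (Continuous.intervalIntegrable (by fun_prop) _ _)
          (by simp), intervalIntegral.integral_const_mul, intervalIntegral.integral_const,
          smul_eq_mul, hκ]
        field_simp
        ring
      have hF := GenPoisson.isGenDeriv_integral (α := α) (r := r) (β := β) hΦ0
      have hFx := GenPoisson.sub_interp_eq_integral hw hn (hΦc.intervalIntegrable _ _) hF x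
      have hK0 := GenPoisson.integral_errKernel_mul_trigPoly hw hn β x hs
        (GenPoisson.const_mem_trigPoly hn κ)
      set K := GenPoisson.errKernel n α r β x
      set V := ∫ t in (-π)..π, K t * s t with hV
      have hKΦ : ∫ t in (-π)..π, K t * Φ t = E * V := by
        have e : ∀ t, K t * Φ t = E * (K t * s t) - K t * κ := fun t => by simp only [hΦ]; ring
        simp only [e]
        rw [intervalIntegral.integral_sub (Continuous.intervalIntegrable (by fun_prop) _ _)
          (Continuous.intervalIntegrable (by fun_prop) _ _), hK0,
          intervalIntegral.integral_const_mul, sub_zero]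
      have hVle : |V| ≤ I := by
        rw [← Real.norm_eq_abs]
        refine intervalIntegral.norm_integral_le_of_norm_le (by linarith)
          (Filter.Eventually.of_forall fun t _ => ?_)
          (hKc.abs.intervalIntegrable _ _)
        rw [norm_mul, Real.norm_eq_abs, Real.norm_eq_abs]
        exact mul_le_of_le_one_right (abs_nonneg _) (hs1 t)
      have hVge : I - W ≤ |V| := hsint.trans (le_abs_self V)
      rw [hKΦ] at hFx
      refine ⟨_, Φ, ⟨hΦp, hΦc⟩, hF, ?_, 1 / π * |V| / W - Λ, ?_, ?_⟩
      · refine GenPoisson.bestC_eq_of_alternation hn hΦp hΦc (κ := κ) (fun t => ?_) fun i => ?_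
        · simp only [hΦ, sub_add_cancel]
          rw [abs_mul, abs_of_nonneg hE0]
          exact mul_le_of_le_one_right hE0 (hs1 t)
        · simp only [hΦ, sub_add_cancel, hsalt]
      · have h1 : 1 / π * |V| / W - Λ = (1 / π * |V| - W * Λ) / W := by field_simp
        rw [h1, abs_div, abs_of_pos hWpos, div_lt_iff₀ hWpos]
        have hp1 : 1 / π ≤ 1 := by
          rw [div_le_one hπ]; linarith [Real.pi_gt_three]
        have hp0 : 0 < 1 / π := by positivity
        have h2 : 1 / π * |V| ≤ 1 / π * I := by gcongr
        have h3 : 1 / π * (I - W) ≤ 1 / π * |V| := by gcongr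
        have h4 : 1 / π * W ≤ 1 * W := by gcongr
        rw [abs_lt]
        constructor <;> nlinarith
      · rw [hFx, abs_mul, abs_mul, abs_of_pos (by positivity : 0 < 1 / π), abs_of_nonneg hE0]
        field_simp
        ring
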